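/- **Setting.** Let $\mathcal X=\prod_{i=1}^N\mathbb R^{n_i}$ ($N\ge 1$) and $\mathcal Y=\mathbb R^m$ carry their Euclidean norms. Let $g_i:\mathbb R^{n_i}\to\mathbb R\cup\{+\infty\}$ ($1\le i\le N$) and $h:\mathcal Y\to\mathbb R\cup\{+\infty\}$ be closed convex, $g(\mathbf x)=\sum_i g_i(x_i)$, and let $f:\mathcal X\times\mathcal Y\to\mathbb R$ be differentiable on an open set containing $\operatorname{dom}g\times\operatorname{dom}h$, with $\nabla f$ $L$-Lipschitz on $\operatorname{dom} g\times\operatorname{dom}h$ and with $f(\mathbf x,\cdot)$ strongly concave on $\operatorname{dom}h$ with modulus $\mu>0$ for every $\mathbf x\in\operatorname{dom}g$. Put $\mathcal L(\mathbf x,y)=g(\mathbf x)+f(\mathbf x,y)-h(y)$, $F(\mathbf x)=\sup_{y}\mathcal L(\mathbf x,y)$ for $\mathbf x\in\operatorname{dom}g$ and $F(\mathbf x)=+\infty$ otherwise, $\kappa=L/\mu$, and let $\bar F\in\mathbb R$ satisfy $\bar F\le\inf_{\mathbf x} F(\mathbf x)$. For all $(\mathbf x,y)\in\operatorname{dom}g\times\operatorname{dom}h$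 the stochastic oracles satisfy $\mathbf E_\omega[\tilde\nabla_{x_i}f(\mathbf x,y;\omega)]=\nabla_{x_i}f(\mathbf x,y)$, $\mathbf E_\omega\|\tilde\nabla_{x_i}f(\mathbf x,y;\omega)-\nabla_{x_i}f(\mathbf x,y)\|^2\le\sigma_x^2/N$ for all $i$, and $\mathbf E_\zeta[\tilde\nabla_yf(\mathbf x,y;\zeta)]=\nabla_yf(\mathbf x,y)$, $\mathbf E_\zeta\|\tilde\nabla_yf(\mathbf x,y;\zeta)-\nabla_yf(\mathbf x,y)\|^2\le\sigma_y^2$, where $\sigma_x,\sigma_y\ge 0$. **RB-SGDA$(\eta_x,\eta_y,M_x,M_y,K,\mathbf x^0,y^0)$.** For $k=0,\dots,K-1$ draw $i_k$ uniformly from $\{1,\dots,N\}$, an i.i.d. batch $\boldsymbol\omega^k=(\omega^k_j)_{j\le M_x}$ and an i.i.d. batch $\boldsymbol\zeta^k=(\zeta^k_j)_{j\le M_y}$. With the batch averages $s_{x_i}(\mathbf x,y;\boldsymbol\omega)=\frac1{M_x}\sum_j\tilde\nabla_{x_i}f(\mathbf x,y;\omega_j)$ and $s_y(\mathbf x,y;\boldsymbol\zeta)=\frac1{M_y}\sum_j\tilde\nabla_yf(\mathbf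 x,y;\zeta_j)$, set $$x^{k+1}_{i_k}=\operatorname{prox}_{\eta_xg_{i_k}}\!\big(x^k_{i_k}-\eta_xs_{x_{i_k}}(\mathbf x^k,y^k;\boldsymbol\omega^k)\big),\quad x^{k+1}_i=x^k_i\ (i\ne i_k),\quad y^{k+1}=\operatorname{prox}_{\eta_yh}\!\big(y^k+\eta_ys_y(\mathbf x^k,y^k;\boldsymbol\zeta^k)\big).$$ Then draw $\tilde k$ uniformly from $\{0,\dots,K-1\}$ and return $(\mathbf x^{\tilde k},y^{\tilde k})$ together with the stochastic gradient map $\tilde G$ at $(\mathbf x^{\tilde k},y^{\tilde k})$, whose components are $\tilde G_{x_i}=\big[x_i-\operatorname{prox}_{\eta_xg_i}(x_i-\eta_xs_{x_i})\big]/\eta_x$ and $\tilde G_y=\big[\operatorname{prox}_{\eta_yh}(y+\eta_ys_y)-y\big]/\eta_y$, evaluated with the batches $\boldsymbol\omega^{\tilde k},\boldsymbol\zeta^{\tilde k}$. **SGDA-B.** Input: $\epsilon,\tilde\epsilon,\mu>0$, $p,\gamma\in(0,1)$, $\bar F$, $\mathbf x^0\in\operatorname{dom}g$, and a (deterministic)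 $y^0\in\operatorname{dom}h$ with $\sup_y\mathcal L(\mathbf x^0,y)-\mathcal L(\mathbf x^0,y^0)\le\tilde\epsilon$. Put $\rho=\frac{\sqrt{1+12/N}-1}{24}$ and $T=\lceil\log_2(1/p)\rceil$. In the backtracking rounds $\ell=1,2,\dots$ use $\eta_y=\gamma^\ell/\mu$, $\eta_x=N\rho\mu^2\eta_y^3$, $$K=\Big\lceil\tfrac{64N}{\epsilon^2\eta_x}\big(\mathcal L(\mathbf x^0,y^0)-\bar F+(12\rho+1)\tilde\epsilon\big)\Big\rceil,\quad M_x=\Big\lceil\tfrac{128}{\epsilon^2}\sigma_x^2+1\Big\rceil,\quad M_y=\Big\lceil\Big(1+\tfrac{6}{\mu\eta_y}\tfrac{2-\mu\eta_y}{1-\mu\eta_y}\Big)\tfrac{128}{\epsilon^2}\sigma_y^2+1\Big\rceil,$$ make $T$ independent runs of RB-SGDA from $(\mathbf x^0,y^0)$, let $\tilde S_{(t,\ell)}$ be the squared norm of the stochastic gradient map returned by run $t$, and stop in round $\ell$ if $\min_{1\le t\le T}\tilde S_{(t,\ell)}\le\epsilon^2/4$; otherwise go on to round $\ell+1$. All draws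 in different iterations, runs and rounds are independent, and in each run the indices $i_k$, $\tilde k$ are independent of the batches. **Lemma.** Let $I\in\{1,2,\dots\}\cup\{\infty\}$ be the round in which SGDA-B stops. Then: 1. $\mathbf P(I<\infty)=1$. 2. $\mathbf P(I\le\bar\ell)\ge 1-p$, where $\bar\ell=\max\{1,\lceil\log_{1/\gamma}\kappa\rceil\}$ (so $\bar\ell=\lceil\log_{1/\gamma}\kappa\rceil$ whenever $\kappa>1$; if $\kappa=L=0$, put $\bar\ell=1$). 3. For each $\ell\ge1$ for which the step size $\eta_y=\gamma^\ell/\mu$ satisfies $L\eta_y\le1$, $\mathbf P\big(\min_{1\le t\le T}\tilde S_{(t,\ell)}\le\epsilon^2/4\big)\ge1-p$. -/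

import Mathlib

open MeasureTheory ProbabilityTheory
open scoped NNReal ENNReal Gradient

noncomputable section

namespace SGDAB

/-! ### Extended-real convex functions and the proximal map -/

/-- The effective domain of a function with values in `ℝ ∪ {+∞}`. -/
def effDom {E : Type*} (φ : E → EReal) : Set E := {u | φ u < ⊤}

/-- `φ : E → ℝ ∪ {+∞}` is a closed convex function: it never takes the value `-∞`, it is lower
semicontinuous, and its epigraph is convex. -/
structure IsClosedConvex {E : Type*} [NormedAddCommGroup E] [NormedSpace ℝ E]
    (φ : E → EReal) : Prop where
  ne_bot : ∀ u, φ u ≠ ⊥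
  lsc : LowerSemicontinuous φ
  convex_epi : Convex ℝ {q : E × ℝ | φ q.1 ≤ (q.2 : EReal)}

/-- The proximal map `prox_{η φ}(v) = argmin_u φ(u) + ‖u - v‖² / (2η)`. For `η > 0` and a closed
convex `φ` with nonempty effective domain the minimizer exists and is unique. -/
def prox {E : Type*} [NormedAddCommGroup E] (η : ℝ) (φ : E → EReal) (v : E) : E :=
  Classical.epsilon fun u : E => ∀ w : E,
    φ u + ((‖u - v‖ ^ 2 / (2 * η) : ℝ) : EReal) ≤ φ w + ((‖w - v‖ ^ 2 / (2 * η) : ℝ) : EReal)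

/-! ### The minimax problem -/

/-- The primal space `𝒳 = ∏ᵢ ℝ^{nᵢ}` with its Euclidean norm. -/
abbrev Primal {N : ℕ} (n : Fin N → ℕ) : Type := PiLp 2 fun i => EuclideanSpace ℝ (Fin (n i))

/-- The dual space `𝒴 = ℝᵐ` with its Euclidean norm. -/
abbrev Dual (m : ℕ) : Type := EuclideanSpace ℝ (Fin m)

/-- `𝒳 × 𝒴` with its Euclidean norm. -/
abbrev Joint {N : ℕ} (n : Fin N → ℕ) (m : ℕ) : Type := WithLp 2 (Primal n × Dual m)

/-- The point `(x, y)` of `𝒳 × 𝒴`. -/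
abbrev pair {N : ℕ} {n : Fin N → ℕ} {m : ℕ} (x : Primal n) (y : Dual m) : Joint n m :=
  WithLp.toLp 2 (x, y)

/-- The data of the problem `min_x max_y g(x) + f(x, y) - h(y)` with `g(x) = ∑ᵢ gᵢ(xᵢ)`. -/
structure Problem {N : ℕ} (n : Fin N → ℕ) (m : ℕ) where
  g : ∀ i, EuclideanSpace ℝ (Fin (n i)) → EReal
  f : Joint n m → ℝ
  h : Dual m → EReal

namespace Problem

variable {N : ℕ} {n : Fin N → ℕ} {m : ℕ}

/-- `g(x) = ∑ᵢ gᵢ(xᵢ)`. -/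
def gSum (D : Problem n m) (x : Primal n) : EReal := ∑ i, D.g i (x i)

/-- The objective `𝓛(x, y) = g(x) + f(x, y) - h(y)`. -/
def obj (D : Problem n m) (x : Primal n) (y : Dual m) : EReal :=
  D.gSum x + (D.f (pair x y) : EReal) - D.h y

/-- `Φ(x) = max_y f(x, y) - h(y)`. -/
def phi (D : Problem n m) (x : Primal n) : EReal :=
  ⨆ y : Dual m, ((D.f (pair x y) : EReal) - D.h y)

/-- The primal function `F = g + Φ`. -/
def primal (D : Problem n m) (x : Primal n) : EReal := D.gSum x + D.phi x

/-- `dom g × dom h`. -/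
def feasible (D : Problem n m) : Set (Joint n m) :=
  {z | z.fst ∈ effDom D.gSum ∧ z.snd ∈ effDom D.h}

/-- The standing assumptions on the problem, with Lipschitz constant `L`, concavity modulus `μ`
and lower bound `Fbar ≤ F^* = inf_x F(x)`. -/
structure Regular (D : Problem n m) (L : ℝ≥0) (μ Fbar : ℝ) : Prop where
  closedConvex_g : ∀ i, IsClosedConvex (D.g i)
  closedConvex_h : IsClosedConvex D.h
  differentiable : ∃ U : Set (Joint n m), IsOpen U ∧ D.feasible ⊆ U ∧ DifferentiableOn ℝ D.f U
  lipschitz : LipschitzOnWith L (∇ D.f) D.feasible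
  strongConcave : ∀ x ∈ effDom D.gSum,
    StrongConcaveOn (effDom D.h) μ fun y => D.f (pair x y)
  lower : (Fbar : EReal) ≤ ⨅ x : Primal n, D.primal x

end Problem

/-! ### The stochastic first-order oracle -/

/-- Stochastic oracles: `gradX z ω` collects the estimates of the block gradients
`∇_{xᵢ} f(z)`, and `gradY z ζ` is the estimate of `∇_y f(z)`. -/
structure Oracle {N : ℕ} (n : Fin N → ℕ) (m : ℕ) (Ξx Ξy : Type*) where
  gradX : Joint n m → Ξx → Primal n
  gradY : Joint n m → Ξy → Dual m

/-- The oracles are measurable, unbiased, and have variance at most `σx² / N` for each primal block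
and at most `σy²` for the dual variable, at every point of `dom g × dom h`, where `ω ∼ Px` and
`ζ ∼ Py`. -/
structure Oracle.Valid {N : ℕ} {n : Fin N → ℕ} {m : ℕ} {Ξx Ξy : Type*}
    [MeasurableSpace Ξx] [MeasurableSpace Ξy]
    (O : Oracle n m Ξx Ξy) (D : Problem n m) (Px : Measure Ξx) (Py : Measure Ξy)
    (σx σy : ℝ) : Prop where
  measurable_x : Measurable fun q : Joint n m × Ξx => O.gradX q.1 q.2
  measurable_y : Measurable fun q : Joint n m × Ξy => O.gradY q.1 q.2
  integrable_x : ∀ z ∈ D.feasible, ∀ i, Integrable (fun w => O.gradX z w i) Px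
  integrable_y : ∀ z ∈ D.feasible, Integrable (fun w => O.gradY z w) Py
  mean_x : ∀ z ∈ D.feasible, ∀ i, ∫ w, O.gradX z w i ∂Px = (∇ D.f z).fst i
  mean_y : ∀ z ∈ D.feasible, ∫ w, O.gradY z w ∂Py = (∇ D.f z).snd
  integrable_sq_x : ∀ z ∈ D.feasible, ∀ i,
    Integrable (fun w => ‖O.gradX z w i - (∇ D.f z).fst i‖ ^ 2) Px
  integrable_sq_y : ∀ z ∈ D.feasible,
    Integrable (fun w => ‖O.gradY z w - (∇ D.f z).snd‖ ^ 2) Py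
  var_x : ∀ z ∈ D.feasible, ∀ i,
    ∫ w, ‖O.gradX z w i - (∇ D.f z).fst i‖ ^ 2 ∂Px ≤ σx ^ 2 / N
  var_y : ∀ z ∈ D.feasible, ∫ w, ‖O.gradY z w - (∇ D.f z).snd‖ ^ 2 ∂Py ≤ σy ^ 2

section RBSGDA

variable {N : ℕ} {n : Fin N → ℕ} {m : ℕ} {Ξx Ξy : Type*}

/-- The mini-batch estimate `s_x(z; ω) = (1/M) ∑_{j < M} gradX z ω_j`. -/
def batchX (O : Oracle n m Ξx Ξy) (M : ℕ) (ω : ℕ → Ξx) (z : Joint n m) : Primal n :=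
  (1 / (M : ℝ)) • ∑ j ∈ Finset.range M, O.gradX z (ω j)

/-- The mini-batch estimate `s_y(z; ζ) = (1/M) ∑_{j < M} gradY z ζ_j`. -/
def batchY (O : Oracle n m Ξx Ξy) (M : ℕ) (ζ : ℕ → Ξy) (z : Joint n m) : Dual m :=
  (1 / (M : ℝ)) • ∑ j ∈ Finset.range M, O.gradY z (ζ j)

/-- The proximal gradient step in the `i`-th primal block. -/
def proxStepX (D : Problem n m) (O : Oracle n m Ξx Ξy) (ηx : ℝ) (Mx : ℕ) (ω : ℕ → Ξx)
    (z : Joint n m) (i : Fin N) : EuclideanSpace ℝ (Fin (n i)) :=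
  prox ηx (D.g i) (z.fst i - ηx • batchX O Mx ω z i)

/-- The proximal gradient ascent step in the dual variable. -/
def proxStepY (D : Problem n m) (O : Oracle n m Ξx Ξy) (ηy : ℝ) (My : ℕ) (ζ : ℕ → Ξy)
    (z : Joint n m) : Dual m :=
  prox ηy D.h (z.snd + ηy • batchY O My ζ z)

/-- The stochastic gradient map `G̃(z; ξ) = (G̃_x(z; ω), G̃_y(z; ζ))`. -/
def gradMap (D : Problem n m) (O : Oracle n m Ξx Ξy) (ηx ηy : ℝ) (Mx My : ℕ)
    (ω : ℕ → Ξx) (ζ : ℕ → Ξy) (z : Joint n m) : Joint n m :=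
  pair (WithLp.toLp 2 fun i => (1 / ηx) • (z.fst i - proxStepX D O ηx Mx ω z i))
    ((1 / ηy) • (proxStepY D O ηy My ζ z - z.snd))

/-- The iterates `(x^k, y^k)` of RB-SGDA (Jacobi updates) started at `z0`: in iteration `k` only
the primal block `idx k` and the dual variable are updated, with the batches `ω k` and `ζ k`. -/
def rbsgda (D : Problem n m) (O : Oracle n m Ξx Ξy) (ηx ηy : ℝ) (Mx My : ℕ)
    (idx : ℕ → Fin N) (ω : ℕ → ℕ → Ξx) (ζ : ℕ → ℕ → Ξy) (z0 : Joint n m) : ℕ → Joint n m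
  | 0 => z0
  | k + 1 =>
    let z := rbsgda D O ηx ηy Mx My idx ω ζ z0 k
    pair
      (WithLp.toLp 2
        (Function.update (fun i => z.fst i) (idx k) (proxStepX D O ηx Mx (ω k) z (idx k))))
      (proxStepY D O ηy My (ζ k) z)

end RBSGDA

/-! ### SGDA-B -/

/-- The input of SGDA-B, the noise levels `σx, σy` used in its batch sizes, and its initial
point. -/
structure Input {N : ℕ} (n : Fin N → ℕ) (m : ℕ) where
  ε : ℝ
  εtilde : ℝ
  μ : ℝ
  p : ℝ
  γ : ℝ
  Fbar : ℝ
  σx : ℝ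
  σy : ℝ
  x0 : Primal n
  y0 : Dual m

/-- The admissible inputs of SGDA-B; the last field says that `y0` maximizes `𝓛(x0, ·)` up to
`εtilde`. -/
structure Input.Valid {N : ℕ} {n : Fin N → ℕ} {m : ℕ} (A : Input n m) (D : Problem n m) :
    Prop where
  ε_pos : 0 < A.ε
  εtilde_pos : 0 < A.εtilde
  μ_pos : 0 < A.μ
  p_pos : 0 < A.p
  p_lt_one : A.p < 1
  γ_pos : 0 < A.γ
  γ_lt_one : A.γ < 1
  σx_nonneg : 0 ≤ A.σx
  σy_nonneg : 0 ≤ A.σy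
  x0_mem : A.x0 ∈ effDom D.gSum
  y0_mem : A.y0 ∈ effDom D.h
  y0_accurate : ⨆ y : Dual m, D.obj A.x0 y ≤ D.obj A.x0 A.y0 + (A.εtilde : EReal)

namespace Input

variable {N : ℕ} {n : Fin N → ℕ} {m : ℕ}

/-- `ρ = (√(1 + 12/N) - 1) / 24`. -/
def rho (_A : Input n m) : ℝ := (Real.sqrt (1 + 12 / (N : ℝ)) - 1) / 24

/-- The number `T = ⌈log₂(1/p)⌉` of independent RB-SGDA runs in every round. -/
def numRuns (A : Input n m) : ℕ := ⌈Real.logb 2 (1 / A.p)⌉₊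

/-- The estimate `L̃` in round `ℓ`. The rounds are `ℓ = 1, 2, …`; the estimate is `μ/γ` in round
`1` and is divided by `γ` from each round to the next. -/
def lipEst (A : Input n m) : ℕ → ℝ
  | 0 => A.μ
  | ℓ + 1 => A.lipEst ℓ / A.γ

/-- The dual step size in round `ℓ`. -/
def etaY (A : Input n m) (ℓ : ℕ) : ℝ := 1 / A.lipEst ℓ

/-- The primal step size in round `ℓ`. -/
def etaX (A : Input n m) (ℓ : ℕ) : ℝ := N * A.rho * A.μ ^ 2 * A.etaY ℓ ^ 3

/-- The number `K` of RB-SGDA iterations in round `ℓ`. -/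
def numIter (A : Input n m) (D : Problem n m) (ℓ : ℕ) : ℕ :=
  ⌈64 * N / (A.ε ^ 2 * A.etaX ℓ) *
    ((D.obj A.x0 A.y0).toReal - A.Fbar + (12 * A.rho + 1) * A.εtilde)⌉₊

/-- The primal batch size. -/
def batchSizeX (A : Input n m) : ℕ := ⌈128 / A.ε ^ 2 * A.σx ^ 2 + 1⌉₊

/-- The dual batch size in round `ℓ`. -/
def batchSizeY (A : Input n m) (ℓ : ℕ) : ℕ :=
  ⌈(1 + 6 / (A.μ * A.etaY ℓ) * ((2 - A.μ * A.etaY ℓ) / (1 - A.μ * A.etaY ℓ)))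
    * (128 / A.ε ^ 2) * A.σy ^ 2 + 1⌉₊

end Input

/-- The labels of the random draws of SGDA-B with `T` runs per round. -/
inductive Draw (T : ℕ) : Type
  | block (ℓ : ℕ) (t : Fin T) (k : ℕ)
  | noise (ℓ : ℕ) (t : Fin T) (k : ℕ)
  | pick (ℓ : ℕ) (t : Fin T)

/-- The random draws of SGDA-B: in iteration `k` of the `t`-th RB-SGDA run of round `ℓ`, the block
index `block ℓ t k`, and the samples `omega ℓ t k j` and `zeta ℓ t k j` (`j = 0, 1, …`) for the
primal and the dual batch; and the index `pick ℓ t` of the iterate which that run returns. -/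
structure Sampling (N T : ℕ) (Ξx Ξy Ω : Type*) where
  block : ℕ → Fin T → ℕ → Ω → Fin N
  omega : ℕ → Fin T → ℕ → ℕ → Ω → Ξx
  zeta : ℕ → Fin T → ℕ → ℕ → Ω → Ξy
  pick : ℕ → Fin T → Ω → ℕ

/-- The σ-algebra generated by a draw. The two batches of one iteration form a single draw, so
that no independence between the primal and the dual batch of the same iteration is asked for. -/
@[reducible] def Sampling.sigma {N T : ℕ} {Ξx Ξy Ω : Type*} [MeasurableSpace Ξx] [MeasurableSpace Ξy]
    (R : Sampling N T Ξx Ξy Ω) : Draw T → MeasurableSpace Ω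
  | .block ℓ t k => MeasurableSpace.comap (R.block ℓ t k) inferInstance
  | .noise ℓ t k => MeasurableSpace.comap
      (fun a => ((fun j => R.omega ℓ t k j a, fun j => R.zeta ℓ t k j a) :
        (ℕ → Ξx) × (ℕ → Ξy))) inferInstance
  | .pick ℓ t => MeasurableSpace.comap (R.pick ℓ t) inferInstance

/-- The laws of the draws: block indices are uniform, the samples of each batch are i.i.d. with
law `Px` or `Py`, returned indices are uniform on `{0, …, K_ℓ - 1}` with `K_ℓ = K ℓ`, and different
draws are independent. -/
structure Sampling.Valid {N T : ℕ} {Ξx Ξy Ω : Type*} [MeasurableSpace Ξx] [MeasurableSpace Ξy]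
    [MeasurableSpace Ω] (R : Sampling N T Ξx Ξy Ω) (P : Measure Ω) (Px : Measure Ξx)
    (Py : Measure Ξy) (K : ℕ → ℕ) : Prop where
  measurable_block : ∀ ℓ t k, Measurable (R.block ℓ t k)
  measurable_omega : ∀ ℓ t k j, Measurable (R.omega ℓ t k j)
  measurable_zeta : ∀ ℓ t k j, Measurable (R.zeta ℓ t k j)
  measurable_pick : ∀ ℓ t, Measurable (R.pick ℓ t)
  law_block : ∀ ℓ t k, P.map (R.block ℓ t k) = uniformOn Set.univ
  law_omega : ∀ ℓ t k j, P.map (R.omega ℓ t k j) = Px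
  law_zeta : ∀ ℓ t k j, P.map (R.zeta ℓ t k j) = Py
  law_pick : ∀ ℓ t, P.map (R.pick ℓ t) = uniformOn (Set.Iio (K ℓ))
  indep_omega : ∀ ℓ t k, iIndepFun (R.omega ℓ t k) P
  indep_zeta : ∀ ℓ t k, iIndepFun (R.zeta ℓ t k) P
  indep : iIndep R.sigma P

section Algorithm

variable {N : ℕ} {n : Fin N → ℕ} {m : ℕ} {Ξx Ξy Ω : Type*}

/-- `S̃_{(t,ℓ)} = ‖G̃(x̃, ỹ; ξ̃)‖²` for the iterate `(x̃, ỹ)`, and its batch `ξ̃`, returned by the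
`t`-th RB-SGDA run of round `ℓ`. -/
def runValue (A : Input n m) (D : Problem n m) (O : Oracle n m Ξx Ξy)
    (R : Sampling N A.numRuns Ξx Ξy Ω) (ℓ : ℕ) (t : Fin A.numRuns) (a : Ω) : ℝ :=
  let k := R.pick ℓ t a
  let z := rbsgda D O (A.etaX ℓ) (A.etaY ℓ) A.batchSizeX (A.batchSizeY ℓ)
    (fun k => R.block ℓ t k a) (fun k j => R.omega ℓ t k j a) (fun k j => R.zeta ℓ t k j a)
    (pair A.x0 A.y0) k
  ‖gradMap D O (A.etaX ℓ) (A.etaY ℓ) A.batchSizeX (A.batchSizeY ℓ)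
    (fun j => R.omega ℓ t k j a) (fun j => R.zeta ℓ t k j a) z‖ ^ 2

/-- The stopping condition of round `ℓ`: `S̃_{(t*,ℓ)} ≤ ε²/4` for `t* ∈ argmin_t S̃_{(t,ℓ)}`. -/
def stopCond (A : Input n m) (D : Problem n m) (O : Oracle n m Ξx Ξy)
    (R : Sampling N A.numRuns Ξx Ξy Ω) (ℓ : ℕ) (a : Ω) : Prop :=
  ∃ t : Fin A.numRuns, (∀ s, runValue A D O R ℓ t a ≤ runValue A D O R ℓ s a) ∧
    runValue A D O R ℓ t a ≤ A.ε ^ 2 / 4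

/-- The round in which SGDA-B stops: the first round `ℓ ≥ 1` whose stopping condition holds, and
`⊤` if there is none. -/
def stopRound (A : Input n m) (D : Problem n m) (O : Oracle n m Ξx Ξy)
    (R : Sampling N A.numRuns Ξx Ξy Ω) (a : Ω) : ℕ∞ :=
  ⨅ (ℓ : ℕ) (_ : 1 ≤ ℓ ∧ stopCond A D O R ℓ a), (ℓ : ℕ∞)

end Algorithm

end SGDAB

end

/-! Everything rests on one estimate: in a round with `L * η_y ≤ 1`, a single run of RB-SGDA returns
a value above `ε²/4` with probability at most `1/2` (`measure_fail_le_half`). Step sizes, iteration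
numbers and batch sizes of all rounds are deterministic, so different runs use disjoint sets of
independent draws and fail independently (`measureReal_all_fail_le`). All `T` runs of such a round
fail with probability at most `2⁻ᵀ ≤ p`, which is claim 3. Round `ℓ̄` is of this kind because `L
γ^ℓ̄ ≤ μ`, which gives claim 2. So are all later rounds, and never stopping would require
arbitrarily many independent runs to fail, which gives claim 1.

The estimate comes from the Lyapunov function `V = F(x) + 6ρμ ‖y - y_*(x)‖²`, where `y_*(x)`
maximizes `f(x, ·) - h`. Up to noise, a proximal ascent step with `L * η_y ≤ 1` contracts `‖y -
y_*(x)‖²` by the factor `1 - μη_y` (`dual_step`). A proximal block step decreases `F`, up to the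
error of using `∇ₓf(x, y)` instead of `∇ₓf(x, y_*(x))`, which is at most `L ‖y - y_*(x)‖`
(`primal_step`). The target `y_*` moves at most `κ` times as far as `x` (`norm_dualSol_sub_le`). The
equation `4Nρ(12ρ + 1) = 1` and the choice `η_x = Nρμ²η_y³` balance the three effects
(`lyapunov_arith`), and averaging over the uniform block index gives `E V(z⁺) + η_x/(4N) E‖G̃‖² ≤
V(z) + noise` (`lintegral_lyapunov_step`).

Summing over the iterations (`sum_lintegral_cost_le`), the choices of `K`, `M_x`, `M_y` bound the
average of `E‖G̃‖²` by `ε²/8`: the initial gap and the noise contribute `ε²/16` each. The returned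
index is uniform and independent of the run, so Markov's inequality yields the probability `1/2`. -/

noncomputable section

namespace SGDAB

/-! ### Closed convex functions and the proximal map. -/

section Prox

variable {E : Type*} [NormedAddCommGroup E] [InnerProductSpace ℝ E] {φ : E → EReal}

theorem IsClosedConvex.coe_toReal (hφ : IsClosedConvex φ) {u : E} (hu : u ∈ effDom φ) :
    ((φ u).toReal : EReal) = φ u :=
  EReal.coe_toReal (ne_of_lt hu) (hφ.ne_bot u)

theorem IsClosedConvex.le_combo (hφ : IsClosedConvex φ) {u w : E} (hu : u ∈ effDom φ)
    (hw : w ∈ effDom φ) {a b : ℝ} (ha : 0 ≤ a) (hb : 0 ≤ b) (hab : a + b = 1) :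
    φ (a • u + b • w) ≤ ((a * (φ u).toReal + b * (φ w).toReal : ℝ) : EReal) := by
  have h := hφ.convex_epi (x := (u, (φ u).toReal)) (by simp [hφ.coe_toReal hu])
    (y := (w, (φ w).toReal)) (by simp [hφ.coe_toReal hw]) ha hb hab
  simpa using h

theorem IsClosedConvex.convex_effDom (hφ : IsClosedConvex φ) : Convex ℝ (effDom φ) :=
  fun _ hu _ hw _ _ ha hb hab => (hφ.le_combo hu hw ha hb hab).trans_lt (EReal.coe_lt_top _)

theorem IsClosedConvex.toReal_combo_le (hφ : IsClosedConvex φ) {u w : E} (hu : u ∈ effDom φ)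
    (hw : w ∈ effDom φ) {a b : ℝ} (ha : 0 ≤ a) (hb : 0 ≤ b) (hab : a + b = 1) :
    (φ (a • u + b • w)).toReal ≤ a * (φ u).toReal + b * (φ w).toReal := by
  have h := hφ.le_combo hu hw ha hb hab
  rw [← hφ.coe_toReal (hφ.convex_effDom hu hw ha hb hab)] at h
  exact_mod_cast h

/-- A closed convex function has a linear lower bound away from a point of its domain. -/
theorem IsClosedConvex.exists_linear_bound [ProperSpace E] (hφ : IsClosedConvex φ) {u₀ : E}
    (hu₀ : u₀ ∈ effDom φ) :
    ∃ C : ℝ, 0 ≤ C ∧ ∀ u ∈ effDom φ, 1 ≤ ‖u - u₀‖ →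
      (φ u₀).toReal - C * ‖u - u₀‖ ≤ (φ u).toReal := by
  obtain ⟨p, hp, hmin⟩ := LowerSemicontinuousOn.exists_isMinOn
    (Metric.nonempty_closedBall.2 (zero_le_one' ℝ)) (isCompact_closedBall u₀ 1)
    (hφ.lsc.lowerSemicontinuousOn _)
  have hpd : p ∈ effDom φ :=
    lt_of_le_of_lt (b := φ u₀) (hmin (Metric.mem_closedBall_self zero_le_one)) hu₀
  have key : ∀ u ∈ effDom φ, u ∈ Metric.closedBall u₀ 1 → (φ p).toReal ≤ (φ u).toReal := by
    intro u hu hub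
    have : φ p ≤ φ u := hmin hub
    rw [← hφ.coe_toReal hu, ← hφ.coe_toReal hpd] at this
    exact_mod_cast this
  refine ⟨(φ u₀).toReal - (φ p).toReal,
    sub_nonneg.2 (key u₀ hu₀ (Metric.mem_closedBall_self zero_le_one)), fun u hu hr => ?_⟩
  set r := ‖u - u₀‖ with hrdef
  have hr0 : 0 < r := by linarith
  have hinv : r⁻¹ ≤ 1 := inv_le_one_of_one_le₀ hr
  -- The point of the segment from `u₀` to `u` at distance `1` from `u₀` lies in the unit ball,
  -- where `φ ≥ φ p`; convexity extrapolates this bound to `u`.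
  have hcomb := hφ.toReal_combo_le hu₀ hu (a := 1 - r⁻¹) (b := r⁻¹) (by linarith)
    (inv_nonneg.2 hr0.le) (by ring)
  have hq := key _ (hφ.convex_effDom hu₀ hu (a := 1 - r⁻¹) (b := r⁻¹) (by linarith)
    (inv_nonneg.2 hr0.le) (by ring)) (by
      rw [Metric.mem_closedBall, dist_eq_norm]
      have : (1 - r⁻¹) • u₀ + r⁻¹ • u - u₀ = r⁻¹ • (u - u₀) := by module
      rw [this, norm_smul, Real.norm_of_nonneg (inv_nonneg.2 hr0.le), ← hrdef,
        inv_mul_cancel₀ hr0.ne'])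
  have h2 := mul_le_mul_of_nonneg_left (hq.trans hcomb) hr0.le
  have h3 : r * ((1 - r⁻¹) * (φ u₀).toReal + r⁻¹ * (φ u).toReal)
      = (r - 1) * (φ u₀).toReal + (φ u).toReal := by
    field_simp
  rw [h3] at h2
  linarith

/-- A lower semicontinuous function attains its minimum on a compact ball; outside a large ball the
quadratic term outweighs the at most linear decay of `φ`, so `u₀` already does at least as well. -/
theorem exists_isProx [ProperSpace E] (hφ : IsClosedConvex φ) (hne : (effDom φ).Nonempty)
    {η : ℝ} (hη : 0 < η) (v : E) :
    ∃ u : E, ∀ w : E, φ u + ((‖u - v‖ ^ 2 / (2 * η) : ℝ) : EReal) ≤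
      φ w + ((‖w - v‖ ^ 2 / (2 * η) : ℝ) : EReal) := by
  obtain ⟨u₀, hu₀⟩ := hne
  obtain ⟨C, hC, hlin⟩ := hφ.exists_linear_bound hu₀
  set d := ‖u₀ - v‖ with hd
  have hd0 : 0 ≤ d := norm_nonneg _
  have hηC : 0 ≤ η * C := by positivity
  -- For `r ≥ 2d + 2ηC` one has `(r - d)² ≥ d² + 2ηC r`; the summand `1` makes the linear bound,
  -- valid for `r ≥ 1`, applicable.
  set ρ := 1 + 2 * d + 2 * (η * C) with hρ
  have hlsc : LowerSemicontinuous fun u => φ u + ((‖u - v‖ ^ 2 / (2 * η) : ℝ) : EReal) := by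
    refine LowerSemicontinuous.add' hφ.lsc
      (Continuous.lowerSemicontinuous (continuous_coe_real_ereal.comp (by fun_prop)))
      fun u => EReal.continuousAt_add (Or.inr (EReal.coe_ne_bot _)) (Or.inr (EReal.coe_ne_top _))
  obtain ⟨p, hp, hmin⟩ := LowerSemicontinuousOn.exists_isMinOn
    (Metric.nonempty_closedBall.2 (show 0 ≤ ρ by positivity)) (isCompact_closedBall u₀ ρ)
    (hlsc.lowerSemicontinuousOn _)
  refine ⟨p, fun w => ?_⟩
  by_cases hw : w ∈ Metric.closedBall u₀ ρ
  · exact hmin hw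
  · refine (hmin (Metric.mem_closedBall_self (show 0 ≤ ρ by positivity))).trans ?_
    by_cases hwd : w ∈ effDom φ
    · have hr : ρ < ‖w - u₀‖ := by simpa [dist_eq_norm] using hw
      have h1 := hlin w hwd (by linarith)
      simp only
      rw [← hφ.coe_toReal hwd, ← hφ.coe_toReal hu₀]
      norm_cast
      set r := ‖w - u₀‖ with hrdef
      have hr' : 0 ≤ r - d := by linarith
      have htri : r - d ≤ ‖w - v‖ := by
        have := norm_sub_le (w - v) (u₀ - v)
        rw [sub_sub_sub_cancel_right] at this
        linarith
      have h2 : (r - d) ^ 2 ≤ ‖w - v‖ ^ 2 := pow_le_pow_left₀ hr' htri 2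
      have h3 : d ^ 2 + 2 * (η * C) * r ≤ ‖w - v‖ ^ 2 := by nlinarith
      have h4 : d ^ 2 / (2 * η) + C * r ≤ ‖w - v‖ ^ 2 / (2 * η) := by
        rw [le_div_iff₀ (by positivity), add_mul, div_mul_cancel₀ _ (by positivity)]
        linarith
      linarith
    · have : φ w = ⊤ := not_lt_top_iff.1 hwd
      rw [this, EReal.top_add_coe]
      exact le_top

theorem prox_spec [ProperSpace E] (hφ : IsClosedConvex φ) (hne : (effDom φ).Nonempty)
    {η : ℝ} (hη : 0 < η) (v w : E) :
    φ (prox η φ v) + ((‖prox η φ v - v‖ ^ 2 / (2 * η) : ℝ) : EReal) ≤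
      φ w + ((‖w - v‖ ^ 2 / (2 * η) : ℝ) : EReal) :=
  Classical.epsilon_spec (exists_isProx hφ hne hη v) w

theorem prox_mem_effDom [ProperSpace E] (hφ : IsClosedConvex φ) (hne : (effDom φ).Nonempty)
    {η : ℝ} (hη : 0 < η) (v : E) : prox η φ v ∈ effDom φ := by
  obtain ⟨u₀, hu₀⟩ := hne
  have h := prox_spec hφ ⟨u₀, hu₀⟩ hη v u₀
  by_contra hcon
  have htop : φ (prox η φ v) = ⊤ := not_lt_top_iff.1 hcon
  rw [htop, EReal.top_add_coe, ← hφ.coe_toReal hu₀, ← EReal.coe_add] at h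
  exact absurd h (not_le.2 (EReal.coe_lt_top _))

theorem prox_le [ProperSpace E] (hφ : IsClosedConvex φ) {η : ℝ} (hη : 0 < η) (v : E) {u : E}
    (hu : u ∈ effDom φ) :
    (φ (prox η φ v)).toReal + ‖prox η φ v - v‖ ^ 2 / (2 * η) ≤
      (φ u).toReal + ‖u - v‖ ^ 2 / (2 * η) := by
  have h := prox_spec hφ ⟨u, hu⟩ hη v u
  rw [← hφ.coe_toReal (prox_mem_effDom hφ ⟨u, hu⟩ hη v), ← hφ.coe_toReal hu] at h
  exact_mod_cast h

/-- A real number bounded above by every `c * t` with `0 < t < 1` is nonpositive. -/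
theorem nonpos_of_forall_le_mul {q c : ℝ} (h : ∀ t : ℝ, 0 < t → t < 1 → q ≤ c * t) : q ≤ 0 := by
  have ht : Filter.Tendsto (fun t : ℝ => c * t) (nhdsWithin 0 (Set.Ioi 0)) (nhds (c * 0)) :=
    (continuous_const_mul c).continuousAt.tendsto.mono_left nhdsWithin_le_nhds
  rw [mul_zero] at ht
  refine ge_of_tendsto ht ?_
  filter_upwards [Ioo_mem_nhdsGT (zero_lt_one' ℝ)] with t ht
  exact h t ht.1 ht.2

/-- The variational inequality of the proximal point. -/
theorem prox_variational [ProperSpace E] (hφ : IsClosedConvex φ) {η : ℝ} (hη : 0 < η) (v : E)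
    {u : E} (hu : u ∈ effDom φ) :
    η * (φ (prox η φ v)).toReal + inner ℝ (v - prox η φ v) (u - prox η φ v) ≤
      η * (φ u).toReal := by
  set p := prox η φ v with hpdef
  have hp : p ∈ effDom φ := prox_mem_effDom hφ ⟨u, hu⟩ hη v
  -- Comparing `p` with `(1 - t) p + t u` and dividing by `t` gives the claim up to `‖u - p‖² t /
  -- 2`, which vanishes as `t → 0`.
  have := nonpos_of_forall_le_mul
    (q := η * (φ p).toReal + inner ℝ (v - p) (u - p) - η * (φ u).toReal)
    (c := ‖u - p‖ ^ 2 / 2) fun t ht ht1 => by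
      have h1 := prox_le hφ hη v (hφ.convex_effDom hp hu (a := 1 - t) (b := t) (by linarith)
        ht.le (by ring))
      have h2 := hφ.toReal_combo_le hp hu (a := 1 - t) (b := t) (by linarith) ht.le (by ring)
      rw [← hpdef] at h1
      have h3 : (1 - t) • p + t • u - v = (p - v) + t • (u - p) := by module
      rw [h3, norm_add_sq_real, norm_smul, inner_smul_right, Real.norm_of_nonneg ht.le] at h1
      have h4 : inner ℝ (p - v) (u - p) = - inner ℝ (v - p) (u - p) := by
        rw [← inner_neg_left, neg_sub]
      rw [h4] at h1
      have h5 : (φ p).toReal ≤ (1 - t) * (φ p).toReal + t * (φ u).toReal +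
          (2 * (t * -inner ℝ (v - p) (u - p)) + (t * ‖u - p‖) ^ 2) / (2 * η) := by
        have : (‖p - v‖ ^ 2 + 2 * (t * -inner ℝ (v - p) (u - p)) + (t * ‖u - p‖) ^ 2) / (2 * η)
          = ‖p - v‖ ^ 2 / (2 * η) +
            (2 * (t * -inner ℝ (v - p) (u - p)) + (t * ‖u - p‖) ^ 2) / (2 * η) := by ring
        linarith
      rw [← sub_le_iff_le_add', le_div_iff₀ (by positivity)] at h5
      have h6 : t * (η * (φ p).toReal + inner ℝ (v - p) (u - p) - η * (φ u).toReal)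
          ≤ t * (‖u - p‖ ^ 2 / 2 * t) := by nlinarith
      exact le_of_mul_le_mul_left h6 ht
  linarith

/-- Each proximal point is tested in the variational inequality of the other; the sum is firm
nonexpansiveness, `‖p - q‖² ≤ ⟪v - w, p - q⟫`. -/
theorem norm_prox_sub_prox_le [ProperSpace E] (hφ : IsClosedConvex φ)
    (hne : (effDom φ).Nonempty) {η : ℝ} (hη : 0 < η) (v w : E) :
    ‖prox η φ v - prox η φ w‖ ≤ ‖v - w‖ := by
  have h1 := prox_variational hφ hη v (prox_mem_effDom hφ hne hη w)
  have h2 := prox_variational hφ hη w (prox_mem_effDom hφ hne hη v)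
  set p := prox η φ v
  set q := prox η φ w
  have h3 : inner ℝ (v - p) (q - p) + inner ℝ (w - q) (p - q)
      = ‖p - q‖ ^ 2 - inner ℝ (v - w) (p - q) := by
    rw [← real_inner_self_eq_norm_sq, ← neg_sub p q, inner_neg_right, neg_add_eq_sub,
      ← inner_sub_left, ← inner_sub_left]
    congr 1
    abel
  have h4 := real_inner_le_norm (v - w) (p - q)
  have h5 : ‖p - q‖ * ‖p - q‖ ≤ ‖v - w‖ * ‖p - q‖ := by nlinarith
  by_cases h0 : ‖p - q‖ = 0
  · rw [h0]; exact norm_nonneg _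
  · exact le_of_mul_le_mul_right h5 (lt_of_le_of_ne (norm_nonneg _) (Ne.symm h0))

theorem continuous_prox [ProperSpace E] (hφ : IsClosedConvex φ) (hne : (effDom φ).Nonempty)
    {η : ℝ} (hη : 0 < η) : Continuous (prox η φ) :=
  (LipschitzWith.of_dist_le_mul (K := 1) fun v w => by
    simpa [dist_eq_norm] using norm_prox_sub_prox_le hφ hne hη v w).continuous

/-- The proximal gradient inequality at `x` for the direction `s`. -/
theorem prox_step_le [ProperSpace E] (hφ : IsClosedConvex φ) {η : ℝ} (hη : 0 < η) (x s : E)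
    {u : E} (hu : u ∈ effDom φ) :
    (φ (prox η φ (x - η • s))).toReal + inner ℝ s (prox η φ (x - η • s) - u)
      + (‖prox η φ (x - η • s) - x‖ ^ 2 + ‖u - prox η φ (x - η • s)‖ ^ 2) / (2 * η)
      ≤ (φ u).toReal + ‖u - x‖ ^ 2 / (2 * η) := by
  have h1 := prox_variational hφ hη (x - η • s) hu
  set p := prox η φ (x - η • s)
  have h2 : inner ℝ (x - η • s - p) (u - p)
      = inner ℝ (x - p) (u - p) + η * inner ℝ s (p - u) := by
    rw [show x - η • s - p = (x - p) - η • s by abel, inner_sub_left, inner_smul_left,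
      ← neg_sub p u, inner_neg_right, inner_neg_right]
    simp
  have h3 : ‖u - x‖ ^ 2 = ‖u - p‖ ^ 2 + ‖p - x‖ ^ 2 - 2 * inner ℝ (x - p) (u - p) := by
    rw [show u - x = (u - p) - (x - p) by abel, norm_sub_sq_real, norm_sub_rev p x,
      real_inner_comm]
    ring
  rw [h2] at h1
  rw [← sub_nonneg]
  have h4 : (φ u).toReal + ‖u - x‖ ^ 2 / (2 * η) - ((φ p).toReal + inner ℝ s (p - u)
      + (‖p - x‖ ^ 2 + ‖u - p‖ ^ 2) / (2 * η))
      = (η * (φ u).toReal - (η * (φ p).toReal + (inner ℝ (x - p) (u - p)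
        + η * inner ℝ s (p - u)))) / η := by
    rw [h3]; field_simp; ring
  rw [h4]
  exact div_nonneg (by linarith) hη.le

end Prox

/-! ### Quadratic bounds for functions with Lipschitz gradient on a convex set. -/

section Smooth

variable {E : Type*} [NormedAddCommGroup E] [InnerProductSpace ℝ E] [CompleteSpace E]

theorem HasGradientAt.hasDerivAt_segment {f : E → ℝ} {G : E → E} {z d : E} {t : ℝ}
    (hf : HasGradientAt f (G (z + t • d)) (z + t • d)) :
    HasDerivAt (fun s : ℝ => f (z + s • d)) (inner ℝ (G (z + t • d)) d) t := by
  have h1 : HasDerivAt (fun s : ℝ => z + s • d) d t := by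
    simpa using ((hasDerivAt_id t).smul_const d).const_add z
  have h2 := (hasGradientAt_iff_hasFDerivAt.1 hf).comp_hasDerivAt t h1
  rw [InnerProductSpace.toDual_apply_apply] at h2
  exact h2

/-- The descent lemma on a convex set. -/
theorem descent_le {f : E → ℝ} {G : E → E} {C : Set E} {L : ℝ≥0} (hC : Convex ℝ C)
    (hf : ∀ z ∈ C, HasGradientAt f (G z) z) (hL : LipschitzOnWith L G C) {z w : E}
    (hz : z ∈ C) (hw : w ∈ C) :
    f w ≤ f z + inner ℝ (G z) (w - z) + L / 2 * ‖w - z‖ ^ 2 := by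
  set d := w - z with hd
  have hmem : ∀ t ∈ Set.Icc (0 : ℝ) 1, z + t • d ∈ C := fun t ht =>
    hC.add_smul_sub_mem hz hw ht
  -- The segment stays in `C`, where the Lipschitz bound makes this derivative nonpositive;
  -- monotonicity on `[0, 1]` replaces integrating the gradient.
  have hder : ∀ t ∈ Set.Icc (0 : ℝ) 1, HasDerivAt
      (fun s : ℝ => f (z + s • d) - (s * inner ℝ (G z) d + L / 2 * ‖d‖ ^ 2 * s ^ 2))
      (inner ℝ (G (z + t • d)) d - (1 * inner ℝ (G z) d + L / 2 * ‖d‖ ^ 2 * (2 * t))) t := by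
    intro t ht
    have h1 := HasGradientAt.hasDerivAt_segment (hf _ (hmem t ht))
    have h2 : HasDerivAt (fun s : ℝ => s ^ 2) (2 * t) t := by simpa using hasDerivAt_pow 2 t
    exact h1.sub (((hasDerivAt_id t).mul_const _).add (h2.const_mul _))
  have hanti := antitoneOn_of_deriv_nonpos (convex_Icc (0 : ℝ) 1)
    (fun t ht => (hder t ht).continuousAt.continuousWithinAt)
    (fun t ht => (hder t (interior_subset ht)).differentiableAt.differentiableWithinAt)
    (fun t ht => by
      have ht' := interior_subset ht
      rw [(hder t ht').deriv]
      have h1 := hL.dist_le_mul _ (hmem t ht') _ hz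
      rw [dist_eq_norm, dist_eq_norm, add_sub_cancel_left, norm_smul,
        Real.norm_of_nonneg ht'.1] at h1
      have h2 := real_inner_le_norm (G (z + t • d) - G z) d
      rw [inner_sub_left] at h2
      have h3 := mul_le_mul_of_nonneg_right h1 (norm_nonneg d)
      nlinarith)
  have h := hanti (Set.left_mem_Icc.2 zero_le_one) (Set.right_mem_Icc.2 zero_le_one) zero_le_one
  have hzd : z + d = w := by rw [hd]; abel
  simp [hzd] at h
  linarith

theorem le_descent {f : E → ℝ} {G : E → E} {C : Set E} {L : ℝ≥0} (hC : Convex ℝ C)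
    (hf : ∀ z ∈ C, HasGradientAt f (G z) z) (hL : LipschitzOnWith L G C) {z w : E}
    (hz : z ∈ C) (hw : w ∈ C) :
    f z + inner ℝ (G z) (w - z) - L / 2 * ‖w - z‖ ^ 2 ≤ f w := by
  have h := descent_le (f := fun z => - f z) (G := fun z => - G z) hC
    (fun z hz => by
      rw [hasGradientAt_iff_hasFDerivAt, map_neg]
      exact (hasGradientAt_iff_hasFDerivAt.1 (hf z hz)).neg)
    (fun x hx y hy => by rw [edist_neg_neg]; exact hL hx hy) hz hw
  rw [inner_neg_left] at h
  linarith

end Smooth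

/-! ### Effective domains and first-order inequalities for the partial gradients. -/

namespace Problem

variable {N : ℕ} {n : Fin N → ℕ} {m : ℕ} {D : Problem n m} {L : ℝ≥0} {μ Fbar : ℝ}

theorem sum_ne_bot {ι : Type*} (s : Finset ι) {φ : ι → EReal} (h : ∀ i ∈ s, φ i ≠ ⊥) :
    ∑ i ∈ s, φ i ≠ ⊥ := by
  classical
  induction s using Finset.induction_on with
  | empty => simp
  | insert a s ha ih =>
    rw [Finset.sum_insert ha, ne_eq, EReal.add_eq_bot_iff, not_or]
    exact ⟨h a (by simp), ih fun i hi => h i (by simp [hi])⟩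

theorem coe_sum {ι : Type*} (s : Finset ι) (φ : ι → ℝ) :
    ((∑ i ∈ s, φ i : ℝ) : EReal) = ∑ i ∈ s, (φ i : EReal) := by
  classical
  induction s using Finset.induction_on with
  | empty => simp
  | insert a s ha ih => rw [Finset.sum_insert ha, Finset.sum_insert ha, EReal.coe_add, ih]

theorem sum_lt_top_iff {ι : Type*} (s : Finset ι) {φ : ι → EReal} (h : ∀ i ∈ s, φ i ≠ ⊥) :
    ∑ i ∈ s, φ i < ⊤ ↔ ∀ i ∈ s, φ i < ⊤ := by
  classical
  induction s using Finset.induction_on with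
  | empty => simp
  | insert a s ha ih =>
    have hb := sum_ne_bot s fun i hi => h i (by simp [hi])
    rw [Finset.sum_insert ha, Finset.forall_mem_insert, ← ih fun i hi => h i (by simp [hi])]
    constructor
    · intro hlt
      constructor
      · by_contra hc
        rw [not_lt_top_iff.1 hc, EReal.top_add_of_ne_bot hb] at hlt
        exact lt_irrefl _ hlt
      · by_contra hc
        rw [not_lt_top_iff.1 hc, EReal.add_top_of_ne_bot (h a (by simp))] at hlt
        exact lt_irrefl _ hlt
    · rintro ⟨h1, h2⟩
      exact EReal.add_lt_top h1.ne h2.ne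

namespace Regular

theorem mem_effDom_gSum (hD : D.Regular L μ Fbar) {x : Primal n} :
    x ∈ effDom D.gSum ↔ ∀ i, x i ∈ effDom (D.g i) := by
  simpa [effDom, gSum] using sum_lt_top_iff Finset.univ (φ := fun i => D.g i (x i))
    fun i _ => (hD.closedConvex_g i).ne_bot _

theorem gSum_eq (hD : D.Regular L μ Fbar) {x : Primal n} (hx : x ∈ effDom D.gSum) :
    D.gSum x = ((∑ i, (D.g i (x i)).toReal : ℝ) : EReal) := by
  rw [coe_sum]
  exact Finset.sum_congr rfl fun i _ =>
    ((hD.closedConvex_g i).coe_toReal (hD.mem_effDom_gSum.1 hx i)).symm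

theorem convex_feasible (hD : D.Regular L μ Fbar) : Convex ℝ D.feasible := by
  intro z hz w hw a b ha hb hab
  refine ⟨hD.mem_effDom_gSum.2 fun i => ?_, ?_⟩
  · exact (hD.closedConvex_g i).convex_effDom (hD.mem_effDom_gSum.1 hz.1 i)
      (hD.mem_effDom_gSum.1 hw.1 i) ha hb hab
  · exact hD.closedConvex_h.convex_effDom hz.2 hw.2 ha hb hab

theorem hasGradientAt (hD : D.Regular L μ Fbar) {z : Joint n m} (hz : z ∈ D.feasible) :
    HasGradientAt D.f (∇ D.f z) z := by
  obtain ⟨U, hU, hsub, hdiff⟩ := hD.differentiable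
  exact (hdiff.differentiableAt (hU.mem_nhds (hsub hz))).hasGradientAt

theorem pair_mem {x : Primal n} {y : Dual m} (hx : x ∈ effDom D.gSum) (hy : y ∈ effDom D.h) :
    pair x y ∈ D.feasible := ⟨hx, hy⟩

theorem norm_pair_sub_fst (x x' : Primal n) (y : Dual m) :
    ‖pair x' y - pair x y‖ = ‖x' - x‖ := by
  rw [← WithLp.toLp_sub, Prod.mk_sub_mk, sub_self, WithLp.norm_toLp_fst]

theorem norm_pair_sub_snd (x : Primal n) (y y' : Dual m) :
    ‖pair x y' - pair x y‖ = ‖y' - y‖ := by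
  rw [← WithLp.toLp_sub, Prod.mk_sub_mk, sub_self, WithLp.norm_toLp_snd]

theorem f_le_of_fst (hD : D.Regular L μ Fbar) {x x' : Primal n} {y : Dual m}
    (hx : x ∈ effDom D.gSum) (hx' : x' ∈ effDom D.gSum) (hy : y ∈ effDom D.h) :
    D.f (pair x' y) ≤ D.f (pair x y) + inner ℝ (∇ D.f (pair x y)).fst (x' - x)
      + L / 2 * ‖x' - x‖ ^ 2 := by
  have h := descent_le hD.convex_feasible (fun z hz => hD.hasGradientAt hz) hD.lipschitz
    (pair_mem hx hy) (pair_mem hx' hy)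
  rw [norm_pair_sub_fst, WithLp.prod_inner_apply] at h
  simpa using h

theorem le_f_of_snd (hD : D.Regular L μ Fbar) {x : Primal n} {y y' : Dual m}
    (hx : x ∈ effDom D.gSum) (hy : y ∈ effDom D.h) (hy' : y' ∈ effDom D.h) :
    D.f (pair x y) + inner ℝ (∇ D.f (pair x y)).snd (y' - y) - L / 2 * ‖y' - y‖ ^ 2
      ≤ D.f (pair x y') := by
  have h := le_descent hD.convex_feasible (fun z hz => hD.hasGradientAt hz) hD.lipschitz
    (pair_mem hx hy) (pair_mem hx hy')
  rw [norm_pair_sub_snd, WithLp.prod_inner_apply] at h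
  simpa using h

/-- Strong concavity of `f(x, ·)` at first order. -/
theorem f_le_of_snd (hD : D.Regular L μ Fbar) {x : Primal n} {y u : Dual m}
    (hx : x ∈ effDom D.gSum) (hy : y ∈ effDom D.h) (hu : u ∈ effDom D.h) :
    D.f (pair x u) ≤ D.f (pair x y) + inner ℝ (∇ D.f (pair x y)).snd (u - y)
      - μ / 2 * ‖u - y‖ ^ 2 := by
  have hder := HasGradientAt.hasDerivAt_segment (G := ∇ D.f) (z := pair x y)
    (d := pair (0 : Primal n) (u - y)) (t := 0) (by simpa using hD.hasGradientAt (pair_mem hx hy))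
  rw [zero_smul, add_zero, WithLp.prod_inner_apply] at hder
  simp only [inner_zero_right, zero_add] at hder
  have hslope := hder.tendsto_slope_zero_right
  have hlim : Filter.Tendsto (fun t : ℝ => D.f (pair x u) - D.f (pair x y)
      + (1 - t) * (μ / 2 * ‖u - y‖ ^ 2)) (nhdsWithin 0 (Set.Ioi 0))
      (nhds (D.f (pair x u) - D.f (pair x y) + (1 - 0) * (μ / 2 * ‖u - y‖ ^ 2))) := by
    refine (Continuous.tendsto ?_ 0).mono_left nhdsWithin_le_nhds
    fun_prop
  -- Strong concavity between `y` and `u`, divided by `t`, bounds the difference quotient from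
  -- below; as `t → 0⁺` the quotient tends to the directional derivative.
  have hle := le_of_tendsto_of_tendsto hlim hslope (by
    filter_upwards [Ioo_mem_nhdsGT (zero_lt_one' ℝ)] with t ht
    obtain ⟨_, hsc⟩ := hD.strongConcave x hx
    have h := hsc hy hu (a := 1 - t) (b := t) (by linarith [ht.2])
      ht.1.le (by ring)
    have hpt : pair x y + t • pair (0 : Primal n) (u - y)
        = pair x ((1 - t) • y + t • u) := by
      rw [← WithLp.toLp_smul, ← WithLp.toLp_add]
      simp only [Prod.smul_mk, Prod.mk_add_mk, smul_zero, add_zero]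
      congr 2
      module
    simp only [zero_add, zero_smul, add_zero, smul_eq_mul] at h ⊢
    rw [hpt, ← div_eq_inv_mul, le_div_iff₀ ht.1]
    rw [norm_sub_rev y u] at h
    nlinarith)
  have : (∇ D.f (pair x y)).snd = (∇ D.f (pair x y)).ofLp.2 := rfl
  rw [this]
  linarith

theorem norm_grad_sub_le (hD : D.Regular L μ Fbar) {z w : Joint n m}
    (hz : z ∈ D.feasible) (hw : w ∈ D.feasible) :
    ‖∇ D.f z - ∇ D.f w‖ ≤ L * ‖z - w‖ := by
  simpa [dist_eq_norm] using hD.lipschitz.dist_le_mul _ hz _ hw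

theorem norm_fst_le (z : Joint n m) : ‖z.fst‖ ≤ ‖z‖ := by
  refine le_of_sq_le_sq ?_ (norm_nonneg _)
  rw [WithLp.prod_norm_sq_eq_of_L2]
  nlinarith [sq_nonneg ‖z.snd‖]

theorem norm_snd_le (z : Joint n m) : ‖z.snd‖ ≤ ‖z‖ := by
  refine le_of_sq_le_sq ?_ (norm_nonneg _)
  rw [WithLp.prod_norm_sq_eq_of_L2]
  nlinarith [sq_nonneg ‖z.fst‖]

theorem norm_gradX_sub_le (hD : D.Regular L μ Fbar) {x : Primal n} {y y' : Dual m}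
    (hx : x ∈ effDom D.gSum) (hy : y ∈ effDom D.h) (hy' : y' ∈ effDom D.h) :
    ‖(∇ D.f (pair x y')).fst - (∇ D.f (pair x y)).fst‖ ≤ L * ‖y' - y‖ := by
  have h := hD.norm_grad_sub_le (pair_mem hx hy') (pair_mem hx hy)
  rw [norm_pair_sub_snd] at h
  exact (norm_fst_le (∇ D.f (pair x y') - ∇ D.f (pair x y))).trans h

theorem norm_gradY_sub_le_snd (hD : D.Regular L μ Fbar) {x : Primal n} {y y' : Dual m}
    (hx : x ∈ effDom D.gSum) (hy : y ∈ effDom D.h) (hy' : y' ∈ effDom D.h) :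
    ‖(∇ D.f (pair x y')).snd - (∇ D.f (pair x y)).snd‖ ≤ L * ‖y' - y‖ := by
  have h := hD.norm_grad_sub_le (pair_mem hx hy') (pair_mem hx hy)
  rw [norm_pair_sub_snd] at h
  exact (norm_snd_le (∇ D.f (pair x y') - ∇ D.f (pair x y))).trans h

theorem norm_gradY_sub_le_fst (hD : D.Regular L μ Fbar) {x x' : Primal n} {y : Dual m}
    (hx : x ∈ effDom D.gSum) (hx' : x' ∈ effDom D.gSum) (hy : y ∈ effDom D.h) :
    ‖(∇ D.f (pair x' y)).snd - (∇ D.f (pair x y)).snd‖ ≤ L * ‖x' - x‖ := by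
  have h := hD.norm_grad_sub_le (pair_mem hx' hy) (pair_mem hx hy)
  rw [norm_pair_sub_fst] at h
  exact (norm_snd_le (∇ D.f (pair x' y) - ∇ D.f (pair x y))).trans h

theorem inner_gradY_sub_le (hD : D.Regular L μ Fbar) {x : Primal n} {y y' : Dual m}
    (hx : x ∈ effDom D.gSum) (hy : y ∈ effDom D.h) (hy' : y' ∈ effDom D.h) :
    inner ℝ ((∇ D.f (pair x y')).snd - (∇ D.f (pair x y)).snd) (y' - y)
      ≤ - (μ * ‖y' - y‖ ^ 2) := by
  have h1 := hD.f_le_of_snd hx hy hy'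
  have h2 := hD.f_le_of_snd hx hy' hy
  rw [← neg_sub y' y, inner_neg_right, norm_neg] at h2
  rw [inner_sub_left]
  linarith

end Regular

end Problem

/-! ### The dual maximizer, the max function, and the two proximal steps. -/

namespace Problem

variable {N : ℕ} {n : Fin N → ℕ} {m : ℕ} {D : Problem n m} {L : ℝ≥0} {μ Fbar : ℝ}

/-- `y` satisfies the first-order optimality condition of `max_y f(x, y) - h(y)`. -/
def IsDualSol (D : Problem n m) (x : Primal n) (y : Dual m) : Prop :=
  y ∈ effDom D.h ∧ ∀ u ∈ effDom D.h,
    (D.h y).toReal + inner ℝ (∇ D.f (pair x y)).snd (u - y) ≤ (D.h u).toReal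

/-- The maximizer `y_*(x)` of `f(x, ·) - h`. -/
def dualSol (D : Problem n m) (x : Primal n) : Dual m := Classical.epsilon (D.IsDualSol x)

/-- The real value of `Φ(x) = max_y f(x, y) - h(y)`. -/
def phiReal (D : Problem n m) (x : Primal n) : ℝ :=
  D.f (pair x (D.dualSol x)) - (D.h (D.dualSol x)).toReal

/-- The real value of the primal function `F(x)`. -/
def primalReal (D : Problem n m) (x : Primal n) : ℝ :=
  ∑ i, (D.g i (x i)).toReal + D.phiReal x

namespace Regular

/-- Strong monotonicity of `-∇_y f(x, ·)` is available only on `dom h`, which need not be closed.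
Hence the forward-backward map is taken in the order prox, then gradient step: `prox` maps the
complete space nonexpansively into `dom h`, and the gradient step contracts there. At a fixed point
`v` one has `v - prox v = τ ∇_y f(x, prox v)`, so the variational inequality at `v` is the
optimality condition at `prox v`. -/
theorem exists_isDualSol (hD : D.Regular L μ Fbar) (hμ : 0 < μ) (hne : (effDom D.h).Nonempty)
    {x : Primal n} (hx : x ∈ effDom D.gSum) : ∃ y, D.IsDualSol x y := by
  -- This choice gives `1 - 2τμ + τ²L² ≤ 1 - τμ < 1`; the summand `μ²` covers `L = 0` and ensures
  -- `τμ ≤ 1`.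
  set τ : ℝ := μ / (L ^ 2 + μ ^ 2) with hτdef
  have hden : 0 < (L : ℝ) ^ 2 + μ ^ 2 := by positivity
  have hτ : 0 < τ := by positivity
  have hτ1 : τ ^ 2 * (L : ℝ) ^ 2 ≤ τ * μ := by
    have h1 : τ * ((L : ℝ) ^ 2 + μ ^ 2) = μ := div_mul_cancel₀ _ hden.ne'
    have h2 : τ * (τ * ((L : ℝ) ^ 2 + μ ^ 2)) = τ * μ := by rw [h1]
    have h3 : 0 ≤ τ ^ 2 * μ ^ 2 := by positivity
    linarith [show τ * (τ * ((L : ℝ) ^ 2 + μ ^ 2)) = τ ^ 2 * L ^ 2 + τ ^ 2 * μ ^ 2 by ring]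
  have hτμ : τ * μ ≤ 1 := by
    rw [hτdef, div_mul_eq_mul_div, div_le_one hden]
    nlinarith [sq_nonneg (L : ℝ)]
  set q : ℝ := Real.sqrt (1 - τ * μ) with hq
  have hq0 : 0 ≤ q := Real.sqrt_nonneg _
  have hqsq : q ^ 2 = 1 - τ * μ := Real.sq_sqrt (by linarith)
  have hq1 : q < 1 := by
    have : q ^ 2 < 1 ^ 2 := by rw [hqsq]; nlinarith [mul_pos hτ hμ]
    exact lt_of_pow_lt_pow_left₀ 2 zero_le_one this
  let S : Dual m → Dual m := fun v =>
    prox τ D.h v + τ • (∇ D.f (pair x (prox τ D.h v))).snd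
  have hmem := prox_mem_effDom hD.closedConvex_h hne hτ
  have hS : ContractingWith ⟨q, hq0⟩ S := by
    refine ⟨by exact_mod_cast hq1, LipschitzWith.of_dist_le_mul fun v w => ?_⟩
    rw [dist_eq_norm, dist_eq_norm]
    have h0 := norm_prox_sub_prox_le hD.closedConvex_h hne hτ v w
    have h1 := hD.inner_gradY_sub_le hx (hmem w) (hmem v)
    have h2 := hD.norm_gradY_sub_le_snd hx (hmem w) (hmem v)
    set p := prox τ D.h v with hp
    set r := prox τ D.h w with hr
    set G := (∇ D.f (pair x p)).snd - (∇ D.f (pair x r)).snd with hG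
    have h3 : S v - S w = (p - r) + τ • G := by
      simp only [S, ← hp, ← hr, hG]
      module
    have h4 : ‖S v - S w‖ ^ 2 ≤ (q * ‖p - r‖) ^ 2 := by
      rw [h3, norm_add_sq_real, norm_smul, inner_smul_right, Real.norm_of_nonneg hτ.le, mul_pow,
        mul_pow, hqsq, real_inner_comm]
      have h5 : ‖G‖ ^ 2 ≤ (L * ‖p - r‖) ^ 2 := pow_le_pow_left₀ (norm_nonneg _) h2 2
      have h6 := mul_le_mul_of_nonneg_left h5 (sq_nonneg τ)
      have h7 := mul_le_mul_of_nonneg_left h1 hτ.le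
      have h8 := mul_le_mul_of_nonneg_right hτ1 (sq_nonneg ‖p - r‖)
      nlinarith
    have h5 : ‖S v - S w‖ ≤ q * ‖p - r‖ := le_of_sq_le_sq h4 (by positivity)
    exact h5.trans (mul_le_mul_of_nonneg_left h0 hq0)
  have hfix : S (hS.fixedPoint S) = hS.fixedPoint S := hS.fixedPoint_isFixedPt
  set v := hS.fixedPoint S
  refine ⟨prox τ D.h v, hmem v, fun u hu => ?_⟩
  have h1 := prox_variational hD.closedConvex_h hτ v hu
  have h2 : v - prox τ D.h v = τ • (∇ D.f (pair x (prox τ D.h v))).snd := by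
    rw [sub_eq_iff_eq_add']
    exact hfix.symm
  rw [h2, inner_smul_left] at h1
  simp only [conj_trivial] at h1
  rw [← mul_add] at h1
  exact le_of_mul_le_mul_left h1 hτ

variable {x x' : Primal n} {u : Dual m}

theorem isDualSol_dualSol (hD : D.Regular L μ Fbar) (hμ : 0 < μ) (hne : (effDom D.h).Nonempty)
    (hx : x ∈ effDom D.gSum) : D.IsDualSol x (D.dualSol x) :=
  Classical.epsilon_spec (hD.exists_isDualSol hμ hne hx)

theorem dualSol_mem (hD : D.Regular L μ Fbar) (hμ : 0 < μ) (hne : (effDom D.h).Nonempty)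
    (hx : x ∈ effDom D.gSum) : D.dualSol x ∈ effDom D.h :=
  (hD.isDualSol_dualSol hμ hne hx).1

/-- Quadratic growth of `f(x, ·) - h` around its maximizer. -/
theorem dual_growth (hD : D.Regular L μ Fbar) (hμ : 0 < μ) (hx : x ∈ effDom D.gSum)
    (hu : u ∈ effDom D.h) :
    D.f (pair x u) - (D.h u).toReal ≤ D.phiReal x - μ / 2 * ‖u - D.dualSol x‖ ^ 2 := by
  have h := hD.isDualSol_dualSol hμ ⟨u, hu⟩ hx
  have h1 := h.2 u hu
  have h2 := hD.f_le_of_snd hx h.1 hu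
  rw [phiReal]
  linarith

/-- Each maximizer is tested in the optimality condition of the other; by strong monotonicity `μ ‖y'
- y‖²` is then at most the pairing of `y' - y` with the change of `∇_y f(·, y)` from `x` to `x'`. -/
theorem norm_dualSol_sub_le (hD : D.Regular L μ Fbar) (hμ : 0 < μ)
    (hne : (effDom D.h).Nonempty) (hx : x ∈ effDom D.gSum) (hx' : x' ∈ effDom D.gSum) :
    ‖D.dualSol x' - D.dualSol x‖ ≤ L / μ * ‖x' - x‖ := by
  have h := hD.isDualSol_dualSol hμ hne hx
  have h' := hD.isDualSol_dualSol hμ hne hx'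
  set y := D.dualSol x
  set y' := D.dualSol x'
  have h1 := h.2 y' h'.1
  have h2 := h'.2 y h.1
  have h3 := hD.inner_gradY_sub_le hx' h.1 h'.1
  have h4 := hD.norm_gradY_sub_le_fst hx hx' h.1
  have h5 := real_inner_le_norm ((∇ D.f (pair x' y)).snd - (∇ D.f (pair x y)).snd) (y' - y)
  have h6 := mul_le_mul_of_nonneg_right h4 (norm_nonneg (y' - y))
  rw [inner_sub_left] at h3 h5
  rw [← neg_sub y' y, inner_neg_right] at h2
  have h7 : μ * ‖y' - y‖ * ‖y' - y‖ ≤ L * ‖x' - x‖ * ‖y' - y‖ := by nlinarith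
  rw [div_mul_eq_mul_div, le_div_iff₀ hμ, mul_comm]
  by_cases h0 : ‖y' - y‖ = 0
  · rw [h0, mul_zero]; positivity
  · exact le_of_mul_le_mul_right h7 (lt_of_le_of_ne (norm_nonneg _) (Ne.symm h0))

/-- The max function is `L (1 + L/μ)`-smooth from above. -/
theorem phiReal_le (hD : D.Regular L μ Fbar) (hμ : 0 < μ)
    (hne : (effDom D.h).Nonempty) (hx : x ∈ effDom D.gSum) (hx' : x' ∈ effDom D.gSum) :
    D.phiReal x' ≤ D.phiReal x + inner ℝ (∇ D.f (pair x (D.dualSol x))).fst (x' - x)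
      + L * (1 + L / μ) / 2 * ‖x' - x‖ ^ 2 := by
  have hy := hD.dualSol_mem hμ hne hx
  have hy' := hD.dualSol_mem hμ hne hx'
  -- Differentiability of the max function is not used: `f(·, y')` is expanded in `x` at the new
  -- maximizer `y'`, and the growth term `-(μ/2)‖y' - y‖²` pays for replacing `y'` by `y` in the
  -- gradient.
  have h1 := hD.dual_growth hμ hx hy'
  have h2 := hD.f_le_of_fst hx hx' hy'
  have h3 := hD.norm_gradX_sub_le hx hy hy'
  rw [phiReal]
  set y := D.dualSol x
  set y' := D.dualSol x'
  have h4 := real_inner_le_norm ((∇ D.f (pair x y')).fst - (∇ D.f (pair x y)).fst) (x' - x)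
  have h5 := mul_le_mul_of_nonneg_right h3 (norm_nonneg (x' - x))
  rw [inner_sub_left] at h4
  have h6 : L * ‖y' - y‖ * ‖x' - x‖
      ≤ μ / 2 * ‖y' - y‖ ^ 2 + L ^ 2 / (2 * μ) * ‖x' - x‖ ^ 2 := by
    have : μ / 2 * ‖y' - y‖ ^ 2 + L ^ 2 / (2 * μ) * ‖x' - x‖ ^ 2 - L * ‖y' - y‖ * ‖x' - x‖
        = (μ * ‖y' - y‖ - L * ‖x' - x‖) ^ 2 / (2 * μ) := by
      field_simp; ring
    have h0 : 0 ≤ (μ * ‖y' - y‖ - L * ‖x' - x‖) ^ 2 / (2 * μ) := by positivity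
    linarith
  have h7 : L * (1 + L / μ) / 2 * ‖x' - x‖ ^ 2
      = L / 2 * ‖x' - x‖ ^ 2 + L ^ 2 / (2 * μ) * ‖x' - x‖ ^ 2 := by
    field_simp
  linarith

/-- Transfers the extended-real lower bound to real values. It suffices that `phi ≤ phiReal`:
quadratic growth handles `u ∈ dom h`, and elsewhere the term in the supremum is `⊥`. -/
theorem Fbar_le_primalReal (hD : D.Regular L μ Fbar) (hμ : 0 < μ) (hx : x ∈ effDom D.gSum) : Fbar ≤ D.primalReal x := by
  have h1 : D.phi x ≤ (D.phiReal x : EReal) := by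
    refine iSup_le fun u => ?_
    by_cases hu : u ∈ effDom D.h
    · rw [← hD.closedConvex_h.coe_toReal hu, ← EReal.coe_sub]
      have h := hD.dual_growth hμ hx hu
      have h0 : 0 ≤ μ / 2 * ‖u - D.dualSol x‖ ^ 2 := by positivity
      exact_mod_cast (by linarith : D.f (pair x u) - (D.h u).toReal ≤ D.phiReal x)
    · have htop : D.h u = ⊤ := not_lt_top_iff.1 hu
      simp [htop, sub_eq_add_neg]
  have h2 : (Fbar : EReal) ≤ D.primal x := hD.lower.trans (iInf_le _ x)
  rw [primal, hD.gSum_eq hx] at h2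
  have h3 := h2.trans (add_le_add_right h1 _)
  rw [primalReal]
  exact_mod_cast h3

/-- Optimality of the dual gradient step with a perturbed gradient. -/
theorem dual_step (hD : D.Regular L μ Fbar) (hμ : 0 < μ) {η : ℝ} (hη : 0 < η)
    (hLη : L * η ≤ 1) (hx : x ∈ effDom D.gSum) {y : Dual m} (hy : y ∈ effDom D.h)
    (s : Dual m) :
    ‖prox η D.h (y + η • s) - D.dualSol x‖ ^ 2 ≤ (1 - μ * η) * ‖y - D.dualSol x‖ ^ 2
      + 2 * η * inner ℝ (s - (∇ D.f (pair x y)).snd)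
        (prox η D.h (y + η • (∇ D.f (pair x y)).snd) - D.dualSol x)
      + 2 * η ^ 2 * ‖s - (∇ D.f (pair x y)).snd‖ ^ 2 := by
  have hsol := hD.dualSol_mem hμ ⟨y, hy⟩ hx
  have h1 := prox_step_le hD.closedConvex_h hη y (-s) hsol
  rw [smul_neg, sub_neg_eq_add] at h1
  have hp := prox_mem_effDom hD.closedConvex_h ⟨y, hy⟩ hη (y + η • s)
  have h2 := hD.le_f_of_snd hx hy hp
  have h3 := hD.f_le_of_snd hx hy hsol
  have h4 := hD.dual_growth hμ hx hp
  rw [phiReal] at h4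
  have h5 := norm_prox_sub_prox_le hD.closedConvex_h ⟨y, hy⟩ hη (y + η • s)
    (y + η • (∇ D.f (pair x y)).snd)
  rw [add_sub_add_left_eq_sub, ← smul_sub, norm_smul, Real.norm_of_nonneg hη.le] at h5
  set p := prox η D.h (y + η • s)
  set q := prox η D.h (y + η • (∇ D.f (pair x y)).snd)
  set g := (∇ D.f (pair x y)).snd
  set w := D.dualSol x
  have h6 := real_inner_le_norm (s - g) (p - q)
  have h7 := mul_le_mul_of_nonneg_left h5 (norm_nonneg (s - g))
  -- The noise-free step `q` does not depend on `s`, so for unbiased `s` the pairing with `q - w`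
  -- has mean zero; the pairing with `p - q` is at most `η ‖s - g‖²` by nonexpansiveness.
  have h8 : inner ℝ (s - g) (p - w) = inner ℝ (s - g) (p - q) + inner ℝ (s - g) (q - w) := by
    rw [← inner_add_right, sub_add_sub_cancel]
  have h9 : inner ℝ (-s) (p - w) + inner ℝ g (p - y) - inner ℝ g (w - y)
      = - inner ℝ (s - g) (p - w) := by
    simp only [inner_neg_left, inner_sub_left, inner_sub_right]
    ring
  rw [norm_sub_rev w p, norm_sub_rev w y] at h1
  rw [norm_sub_rev w y] at h3
  -- This is where `L η ≤ 1` enters: the proximal term absorbs the smoothness error.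
  have h10 : L / 2 * ‖p - y‖ ^ 2 ≤ ‖p - y‖ ^ 2 / (2 * η) := by
    rw [le_div_iff₀ (by positivity)]
    nlinarith [sq_nonneg ‖p - y‖]
  have h11 : ‖p - w‖ ^ 2 / (2 * η) ≤ ‖y - w‖ ^ 2 / (2 * η) - μ / 2 * ‖y - w‖ ^ 2
      + inner ℝ (s - g) (q - w) + η * ‖s - g‖ ^ 2 := by
    have h12 : 0 ≤ μ / 2 * ‖p - w‖ ^ 2 := by positivity
    rw [add_div] at h1
    nlinarith
  rw [div_le_iff₀ (by positivity)] at h11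
  have h13 : (‖y - w‖ ^ 2 / (2 * η) - μ / 2 * ‖y - w‖ ^ 2
      + inner ℝ (s - g) (q - w) + η * ‖s - g‖ ^ 2) * (2 * η)
      = (1 - μ * η) * ‖y - w‖ ^ 2 + 2 * η * inner ℝ (s - g) (q - w)
        + 2 * η ^ 2 * ‖s - g‖ ^ 2 := by
    field_simp
  linarith

end Regular

/-- The primal point obtained from `x` by replacing its `i`-th block with `v`. -/
def setBlock (x : Primal n) (i : Fin N) (v : EuclideanSpace ℝ (Fin (n i))) : Primal n :=
  WithLp.toLp 2 (Function.update (fun j => x j) i v)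

theorem inner_setBlock_sub (x w : Primal n) (i : Fin N) (v : EuclideanSpace ℝ (Fin (n i))) :
    inner ℝ w (setBlock x i v - x) = inner ℝ (w i) (v - x i) := by
  rw [PiLp.inner_apply, Finset.sum_eq_single i]
  · simp [setBlock]
  · intro j _ hj
    simp [setBlock, Function.update_of_ne hj]
  · simp

theorem norm_setBlock_sub (x : Primal n) (i : Fin N) (v : EuclideanSpace ℝ (Fin (n i))) :
    ‖setBlock x i v - x‖ = ‖v - x i‖ := by
  rw [← sq_eq_sq₀ (norm_nonneg _) (norm_nonneg _), ← real_inner_self_eq_norm_sq,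
    ← real_inner_self_eq_norm_sq, inner_setBlock_sub]
  simp [setBlock]

namespace Regular

variable {x : Primal n}

theorem setBlock_mem (hD : D.Regular L μ Fbar) (hx : x ∈ effDom D.gSum) {i : Fin N}
    {v : EuclideanSpace ℝ (Fin (n i))} (hv : v ∈ effDom (D.g i)) :
    setBlock x i v ∈ effDom D.gSum := by
  rw [hD.mem_effDom_gSum] at hx ⊢
  intro j
  by_cases h : j = i
  · subst h; simpa [setBlock] using hv
  · simpa [setBlock, Function.update_of_ne h] using hx j

/-- Decrease of the primal function in a proximal step in block `i` with a perturbed gradient. -/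
theorem primal_step (hD : D.Regular L μ Fbar) (hμ : 0 < μ) {τ : ℝ} (hτ : 0 < τ)
    (hx : x ∈ effDom D.gSum) {y : Dual m} (hy : y ∈ effDom D.h) (i : Fin N)
    (s : EuclideanSpace ℝ (Fin (n i))) :
    D.primalReal (setBlock x i (prox τ (D.g i) (x i - τ • s))) ≤ D.primalReal x
      - (1 / (2 * τ) - L * (1 + L / μ) / 2) * ‖prox τ (D.g i) (x i - τ • s) - x i‖ ^ 2
      + τ / 2 * ‖((∇ D.f (pair x (D.dualSol x))).fst - (∇ D.f (pair x y)).fst) i‖ ^ 2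
      + inner ℝ ((∇ D.f (pair x y)).fst i - s)
        (prox τ (D.g i) (x i - τ • (∇ D.f (pair x y)).fst i) - x i)
      + τ * ‖(∇ D.f (pair x y)).fst i - s‖ ^ 2 := by
  have hxi := hD.mem_effDom_gSum.1 hx i
  have h1 := prox_step_le (hD.closedConvex_g i) hτ (x i) s hxi
  have hp := prox_mem_effDom (hD.closedConvex_g i) ⟨_, hxi⟩ hτ (x i - τ • s)
  have h2 := hD.phiReal_le hμ ⟨y, hy⟩ hx (hD.setBlock_mem hx hp)
  have h5 := norm_prox_sub_prox_le (hD.closedConvex_g i) ⟨_, hxi⟩ hτ (x i - τ • s)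
    (x i - τ • (∇ D.f (pair x y)).fst i)
  rw [sub_sub_sub_cancel_left, ← smul_sub, norm_smul, Real.norm_of_nonneg hτ.le] at h5
  rw [norm_setBlock_sub, inner_setBlock_sub] at h2
  set p := prox τ (D.g i) (x i - τ • s)
  set g := (∇ D.f (pair x y)).fst
  set q := prox τ (D.g i) (x i - τ • g i)
  set g' := (∇ D.f (pair x (D.dualSol x))).fst with hg'
  have hg'2 : (∇ D.f (pair x (D.dualSol x))).fst.ofLp i = g' i := rfl
  have h6 := real_inner_le_norm (g i - s) (p - q)
  have h7 := mul_le_mul_of_nonneg_left h5 (norm_nonneg (g i - s))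
  have h8 : inner ℝ (g i - s) (p - x i)
      = inner ℝ (g i - s) (p - q) + inner ℝ (g i - s) (q - x i) := by
    rw [← inner_add_right, sub_add_sub_cancel]
  have h9 : inner ℝ (g' i) (p - x i) - inner ℝ s (p - x i)
      = inner ℝ ((g' - g) i) (p - x i) + inner ℝ (g i - s) (p - x i) := by
    rw [← inner_sub_left, ← inner_add_left]
    simp
  have h10 := real_inner_le_norm ((g' - g) i) (p - x i)
  -- The proximal inequality at `u = x i` provides `1/τ` times the squared displacement; Young's
  -- inequality spends half of it on the gradient mismatch.
  have h11 : ‖(g' - g) i‖ * ‖p - x i‖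
      ≤ τ / 2 * ‖(g' - g) i‖ ^ 2 + 1 / (2 * τ) * ‖p - x i‖ ^ 2 := by
    have : τ / 2 * ‖(g' - g) i‖ ^ 2 + 1 / (2 * τ) * ‖p - x i‖ ^ 2 - ‖(g' - g) i‖ * ‖p - x i‖
        = (τ * ‖(g' - g) i‖ - ‖p - x i‖) ^ 2 / (2 * τ) := by
      field_simp; ring
    have h0 : 0 ≤ (τ * ‖(g' - g) i‖ - ‖p - x i‖) ^ 2 / (2 * τ) := by positivity
    linarith
  have h12 : ∑ j, (D.g j (setBlock x i p j)).toReal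
      = ∑ j, (D.g j (x j)).toReal + ((D.g i p).toReal - (D.g i (x i)).toReal) := by
    rw [← sub_eq_iff_eq_add', ← Finset.sum_sub_distrib, Finset.sum_eq_single i]
    · simp [setBlock]
    · intro j _ hj
      simp [setBlock, Function.update_of_ne hj]
    · simp
  rw [norm_sub_rev (x i) p, sub_self, norm_zero] at h1
  have h13 : (‖p - x i‖ ^ 2 + ‖p - x i‖ ^ 2) / (2 * τ) = 2 * (1 / (2 * τ) * ‖p - x i‖ ^ 2) := by
    ring
  rw [h13] at h1
  rw [primalReal, primalReal, h12]
  have h14 : (0 : ℝ) ^ 2 / (2 * τ) = 0 := by simp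
  rw [h14] at h1
  nlinarith

end Regular

end Problem

/-! ### The scalar inequality behind the Lyapunov decrease. -/

/-- The conditions on the parameters under which the Lyapunov function decreases in expectation:
`η` and `τ` are the dual and the primal step size. -/
structure AdmissibleSteps (N : ℕ) (L μ ρ η τ : ℝ) : Prop where
  N_pos : 0 < N
  L_nonneg : 0 ≤ L
  μ_pos : 0 < μ
  ρ_pos : 0 < ρ
  η_pos : 0 < η
  μη_lt_one : μ * η < 1
  Lη_le_one : L * η ≤ 1
  ρ_eq : 4 * N * ρ * (12 * ρ + 1) = 1
  τ_eq : τ = N * ρ * μ ^ 2 * η ^ 3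

namespace AdmissibleSteps

variable {N : ℕ} {L μ ρ η τ : ℝ}

theorem τ_pos (h : AdmissibleSteps N L μ ρ η τ) : 0 < τ := by
  have h1 : (0 : ℝ) < N := by exact_mod_cast h.N_pos
  have := h.ρ_pos
  have := h.μ_pos
  have := h.η_pos
  rw [h.τ_eq]
  positivity

/-- With `a = Lη ≤ 1` and `c = μη < 1`, multiplying by `4τ` turns the left side into `Nρ(2ac(a + c)
+ 24ρ(2 - c)a²) ≤ Nρ(4 + 48ρ)`, and the last expression is `1` by the equation for `ρ`. -/
theorem curvature_le (h : AdmissibleSteps N L μ ρ η τ) :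
    L * (1 + L / μ) / 2 + 6 * ρ * μ * ((2 - μ * η) / (μ * η)) * (L / μ) ^ 2 ≤ 1 / (4 * τ) := by
  have hN : (0 : ℝ) < N := by exact_mod_cast h.N_pos
  have hτ := h.τ_pos
  obtain ⟨_, hL, hμ, hρ, hη, hc, hLη, hρe, hτe⟩ := h
  rw [le_div_iff₀ (by positivity)]
  set a := L * η with ha
  set c := μ * η with hcdef
  have hc0 : 0 < c := by positivity
  have ha0 : 0 ≤ a := by positivity
  have h1 : (L * (1 + L / μ) / 2 + 6 * ρ * μ * ((2 - c) / c) * (L / μ) ^ 2) * (4 * τ)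
      = N * ρ * (2 * (a * c * (a + c)) + 24 * ρ * ((2 - c) * a ^ 2)) := by
    rw [hτe, ha, hcdef]
    field_simp
    ring
  rw [h1]
  have h2 : a * c * (a + c) ≤ 2 := by
    have : a * c ≤ 1 := by nlinarith
    have h3 : 0 ≤ a * c := by positivity
    nlinarith
  have h3 : (2 - c) * a ^ 2 ≤ 2 := by nlinarith
  have h4 : 24 * ρ * ((2 - c) * a ^ 2) ≤ 24 * ρ * 2 := by gcongr
  have h5 : N * ρ * (2 * (a * c * (a + c)) + 24 * ρ * ((2 - c) * a ^ 2))
      ≤ N * ρ * (2 * 2 + 24 * ρ * 2) := by gcongr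
  linarith

end AdmissibleSteps

/-- The arithmetic of the Lyapunov decrease. -/
theorem lyapunov_arith {N : ℕ} {L μ ρ η τ : ℝ} (h : AdmissibleSteps N L μ ρ η τ)
    {F F' d Δ ex e2x δ yp yq ey e2y W S : ℝ} (hd : 0 ≤ d) (hδ : 0 ≤ δ)
    (hx : F' ≤ F - (1 / (2 * τ) - L * (1 + L / μ) / 2) * d + τ / 2 * Δ + ex + τ * e2x)
    (hy : yp ≤ (1 - μ * η) * δ + 2 * η * ey + 2 * η ^ 2 * e2y)
    (hq : yq ≤ (2 - μ * η) / (2 * (1 - μ * η)) * yp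
      + (2 - μ * η) / (μ * η) * ((L / μ) ^ 2 * d))
    (hW : W ≤ 2 * yp + 2 * δ) :
    F' + 6 * ρ * μ * yq + τ / (4 * N) * (S / τ ^ 2 + W / η ^ 2)
      ≤ F + 6 * ρ * μ * δ + (-(1 / (4 * τ)) * d + 1 / (4 * N * τ) * S + τ / 2 * Δ
        - 2 * ρ * μ ^ 2 * η * δ + ex + τ * e2x
        + η * ρ * μ * (μ * η + 6 * ((2 - μ * η) / (1 - μ * η))) * (ey + η * e2y)) := by
  have hN : (0 : ℝ) < N := by exact_mod_cast h.N_pos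
  have hτ := h.τ_pos
  have hcurv := h.curvature_le
  obtain ⟨_, hL, hμ, hρ, hη, hc, hLη, hρe, hτe⟩ := h
  have hτη : τ / (4 * N) * (W / η ^ 2) = ρ * μ * (μ * η) / 4 * W := by
    rw [hτe]; field_simp
  have hS : τ / (4 * N) * (S / τ ^ 2) = 1 / (4 * N * τ) * S := by field_simp
  set c := μ * η with hcdef
  have hc0 : 0 < c := by positivity
  have h1c : 0 < 1 - c := by linarith
  have h2c : 0 < 2 - c := by linarith
  -- The Young weight for moving the target from `y_*(x)` to `y_*(x')` is chosen so that the
  -- contraction factor `1 - c` becomes `1 - c/2`.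
  have h1 := mul_le_mul_of_nonneg_left hy
    (show 0 ≤ (2 - c) / (2 * (1 - c)) by positivity)
  have h2 : (2 - c) / (2 * (1 - c)) * ((1 - c) * δ + 2 * η * ey + 2 * η ^ 2 * e2y)
      = (1 - c / 2) * δ + (2 - c) / (1 - c) * (η * (ey + η * e2y)) := by
    field_simp
    ring
  have h3 := mul_le_mul_of_nonneg_left (hq.trans (add_le_add_left (h1.trans_eq h2) _))
    (show 0 ≤ 6 * ρ * μ by positivity)
  -- Budget of `δ`: the contraction gains `3ρμc δ`, the dual part of the gradient map costs at most
  -- `ρμc δ`, and `2ρμc δ` is left for the primal gradient mismatch.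
  have h4 := mul_le_mul_of_nonneg_left
    (hW.trans (add_le_add_left (mul_le_mul_of_nonneg_left hy zero_le_two) _))
    (show 0 ≤ ρ * μ * c / 4 by positivity)
  have h5 : 0 ≤ ρ * μ * c * (c * δ) := by positivity
  have h6 := mul_le_mul_of_nonneg_right hcurv hd
  have h7 : 1 / (2 * τ) = 2 * (1 / (4 * τ)) := by field_simp; norm_num
  rw [h7] at hx
  have h8 : 2 * ρ * μ ^ 2 * η * δ = 2 * (ρ * μ * c * δ) := by rw [hcdef]; ring
  rw [mul_add (τ / (4 * N)), hτη, hS, h8]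
  nlinarith

/-! ### Pathwise Lyapunov inequality for one iteration. -/

namespace Problem

variable {N : ℕ} {n : Fin N → ℕ} {m : ℕ} {D : Problem n m} {L : ℝ≥0} {μ Fbar ρ η τ : ℝ}

/-- One iteration of RB-SGDA with gradient estimates `sx` and `sy`. -/
def blockStep (D : Problem n m) (η τ : ℝ) (z : Joint n m) (i : Fin N) (sx : Primal n)
    (sy : Dual m) : Joint n m :=
  pair (setBlock z.fst i (prox τ (D.g i) (z.fst i - τ • sx i))) (prox η D.h (z.snd + η • sy))

/-- The gradient map with gradient estimates `sx` and `sy`. -/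
def proxGradMap (D : Problem n m) (η τ : ℝ) (z : Joint n m) (sx : Primal n)
    (sy : Dual m) : Joint n m :=
  pair (WithLp.toLp 2 fun i => (1 / τ) • (z.fst i - prox τ (D.g i) (z.fst i - τ • sx i)))
    ((1 / η) • (prox η D.h (z.snd + η • sy) - z.snd))

/-- The Lyapunov function `F(x) + 6ρμ ‖y - y_*(x)‖²`. -/
def lyapunov (D : Problem n m) (μ ρ : ℝ) (z : Joint n m) : ℝ :=
  D.primalReal z.fst + 6 * ρ * μ * ‖z.snd - D.dualSol z.fst‖ ^ 2

/-- The random upper bound for the change of the Lyapunov function. -/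
def stepBound (D : Problem n m) (μ ρ η τ : ℝ) (z : Joint n m) (i : Fin N) (sx : Primal n)
    (sy : Dual m) : ℝ :=
  -(1 / (4 * τ)) * ‖prox τ (D.g i) (z.fst i - τ • sx i) - z.fst i‖ ^ 2
    + 1 / (4 * N * τ) * ∑ j, ‖prox τ (D.g j) (z.fst j - τ • sx j) - z.fst j‖ ^ 2
    + τ / 2 * ‖((∇ D.f (pair z.fst (D.dualSol z.fst))).fst - (∇ D.f z).fst) i‖ ^ 2
    - 2 * ρ * μ ^ 2 * η * ‖z.snd - D.dualSol z.fst‖ ^ 2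
    + inner ℝ ((∇ D.f z).fst i - sx i)
        (prox τ (D.g i) (z.fst i - τ • (∇ D.f z).fst i) - z.fst i)
    + τ * ‖(∇ D.f z).fst i - sx i‖ ^ 2
    + η * ρ * μ * (μ * η + 6 * ((2 - μ * η) / (1 - μ * η))) *
      (inner ℝ (sy - (∇ D.f z).snd) (prox η D.h (z.snd + η • (∇ D.f z).snd) - D.dualSol z.fst)
        + η * ‖sy - (∇ D.f z).snd‖ ^ 2)

theorem norm_proxGradMap_sq (D : Problem n m) (η τ : ℝ) (z : Joint n m) (sx : Primal n)
    (sy : Dual m) :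
    ‖proxGradMap D η τ z sx sy‖ ^ 2
      = (∑ j, ‖prox τ (D.g j) (z.fst j - τ • sx j) - z.fst j‖ ^ 2) / τ ^ 2
        + ‖prox η D.h (z.snd + η • sy) - z.snd‖ ^ 2 / η ^ 2 := by
  rw [WithLp.prod_norm_sq_eq_of_L2, proxGradMap]
  simp only [WithLp.toLp_fst, WithLp.toLp_snd]
  rw [PiLp.norm_sq_eq_of_L2, norm_smul, mul_pow, Finset.sum_div]
  congr 1
  · refine Finset.sum_congr rfl fun j _ => ?_
    simp only
    rw [norm_smul, mul_pow, norm_sub_rev, Real.norm_eq_abs, sq_abs]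
    ring
  · rw [Real.norm_eq_abs, sq_abs]
    ring

namespace Regular

theorem blockStep_mem (hD : D.Regular L μ Fbar) (hτ : 0 < τ) (hη : 0 < η) {z : Joint n m}
    (hz : z ∈ D.feasible) (i : Fin N) (sx : Primal n) (sy : Dual m) :
    blockStep D η τ z i sx sy ∈ D.feasible :=
  ⟨hD.setBlock_mem hz.1 (prox_mem_effDom (hD.closedConvex_g i)
    ⟨_, hD.mem_effDom_gSum.1 hz.1 i⟩ hτ _),
    prox_mem_effDom hD.closedConvex_h ⟨_, hz.2⟩ hη _⟩

/-- One iteration of RB-SGDA changes the Lyapunov function by at most `stepBound`. -/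
theorem lyapunov_step (hD : D.Regular L μ Fbar) (h : AdmissibleSteps N L μ ρ η τ)
    {z : Joint n m} (hz : z ∈ D.feasible) (i : Fin N) (sx : Primal n) (sy : Dual m) :
    D.lyapunov μ ρ (blockStep D η τ z i sx sy) + τ / (4 * N) * ‖proxGradMap D η τ z sx sy‖ ^ 2
      ≤ D.lyapunov μ ρ z + D.stepBound μ ρ η τ z i sx sy := by
  have hmem := hD.blockStep_mem h.τ_pos h.η_pos hz i sx sy
  have hx := hD.primal_step h.μ_pos h.τ_pos hz.1 hz.2 i (sx i)
  have hy := hD.dual_step h.μ_pos h.η_pos h.Lη_le_one hz.1 hz.2 sy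
  have hlip := hD.norm_dualSol_sub_le h.μ_pos ⟨_, hz.2⟩ hz.1 hmem.1
  have hset : (blockStep D η τ z i sx sy).fst
    = setBlock z.fst i (prox τ (D.g i) (z.fst i - τ • sx i)) := rfl
  have hset2 : (blockStep D η τ z i sx sy).snd = prox η D.h (z.snd + η • sy) := rfl
  have hpz : pair z.fst z.snd = z := rfl
  rw [hset, norm_setBlock_sub] at hlip
  rw [hpz] at hx hy
  rw [norm_proxGradMap_sq, lyapunov, lyapunov, stepBound, hset, hset2]
  refine lyapunov_arith h (sq_nonneg _) (sq_nonneg _) hx hy ?_ ?_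
  · have hc := h.μη_lt_one
    have hc0 : 0 < μ * η := mul_pos h.μ_pos h.η_pos
    set c := μ * η
    rw [← mul_pow]
    have h1 := pow_le_pow_left₀ (norm_nonneg _) hlip 2
    set p := prox η D.h (z.snd + η • sy)
    set y := D.dualSol z.fst
    set y' := D.dualSol (setBlock z.fst i (prox τ (D.g i) (z.fst i - τ • sx i)))
    have h2 : ‖p - y'‖ ≤ ‖p - y‖ + ‖y' - y‖ := by
      rw [← sub_sub_sub_cancel_right p y' y]
      exact norm_sub_le _ _
    have h3 := pow_le_pow_left₀ (norm_nonneg _) h2 2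
    -- Young's inequality with ratio `c / (2(1 - c))`; the defect is a perfect square.
    have h4 : (‖p - y‖ + ‖y' - y‖) ^ 2 ≤ (2 - c) / (2 * (1 - c)) * ‖p - y‖ ^ 2
        + (2 - c) / c * ‖y' - y‖ ^ 2 := by
      have h1c : 0 < 1 - c := by linarith
      have h5 : (2 - c) / (2 * (1 - c)) * ‖p - y‖ ^ 2 + (2 - c) / c * ‖y' - y‖ ^ 2
          - (‖p - y‖ + ‖y' - y‖) ^ 2
          = (c * ‖p - y‖ - 2 * (1 - c) * ‖y' - y‖) ^ 2 / (2 * (1 - c) * c) := by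
        field_simp
        ring
      have h6 : 0 ≤ (c * ‖p - y‖ - 2 * (1 - c) * ‖y' - y‖) ^ 2 / (2 * (1 - c) * c) := by
        positivity
      linarith
    have h7 := mul_le_mul_of_nonneg_left h1 (show 0 ≤ (2 - c) / c from
      div_nonneg (by linarith) hc0.le)
    linarith
  · set p := prox η D.h (z.snd + η • sy)
    set y := D.dualSol z.fst
    have h2 : ‖p - z.snd‖ ≤ ‖p - y‖ + ‖z.snd - y‖ := by
      rw [← sub_sub_sub_cancel_right p z.snd y]
      exact norm_sub_le _ _
    have h3 := pow_le_pow_left₀ (norm_nonneg _) h2 2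
    nlinarith [sq_nonneg (‖p - y‖ - ‖z.snd - y‖)]

/-- Stated for the sum over the blocks, which is what averaging over the block index sees; bounding
each block by the full Lipschitz estimate would lose a factor `N`. -/
theorem sum_norm_gradX_sub_sq_le (hD : D.Regular L μ Fbar) (hμ : 0 < μ) {z : Joint n m}
    (hz : z ∈ D.feasible) :
    ∑ i, ‖((∇ D.f (pair z.fst (D.dualSol z.fst))).fst - (∇ D.f z).fst) i‖ ^ 2
      ≤ (L : ℝ) ^ 2 * ‖z.snd - D.dualSol z.fst‖ ^ 2 := by
  rw [← PiLp.norm_sq_eq_of_L2, ← mul_pow, norm_sub_rev z.snd]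
  exact pow_le_pow_left₀ (norm_nonneg _)
    (hD.norm_gradX_sub_le hz.1 hz.2 (hD.dualSol_mem hμ ⟨_, hz.2⟩ hz.1)) 2

end Regular

end Problem

/-! ### Mean and variance of mini-batches. -/

section Batch

variable {Ω : Type*} [MeasurableSpace Ω] {P : Measure Ω}
  {E : Type*} [NormedAddCommGroup E] [InnerProductSpace ℝ E]

theorem integrable_inner_of_sq {X Y : Ω → E} (hX : AEStronglyMeasurable X P)
    (hY : AEStronglyMeasurable Y P) (hX2 : Integrable (fun a => ‖X a‖ ^ 2) P)
    (hY2 : Integrable (fun a => ‖Y a‖ ^ 2) P) : Integrable (fun a => inner ℝ (X a) (Y a)) P := by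
  refine (hX2.add hY2).mono (hX.inner hY) (Filter.Eventually.of_forall fun a => ?_)
  have h1 := abs_real_inner_le_norm (X a) (Y a)
  rw [Pi.add_apply, Real.norm_eq_abs, Real.norm_eq_abs, abs_of_nonneg (a := _ + _) (by positivity)]
  nlinarith [sq_nonneg (‖X a‖ - ‖Y a‖), sq_nonneg ‖X a‖, sq_nonneg ‖Y a‖]

variable [CompleteSpace E] [MeasurableSpace E] [BorelSpace E] [IsProbabilityMeasure P]

/-- The mean of `M` independent unbiased estimates of `g` is unbiased, and its variance is at most
`v / M` if each of them has variance at most `v`. -/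
theorem batch_mean {X : ℕ → Ω → E} {g : E} {v : ℝ} {M : ℕ} (hM : 0 < M)
    (hind : iIndepFun X P) (hint : ∀ j, Integrable (X j) P) (hmean : ∀ j, ∫ a, X j a ∂P = g)
    (hsq : ∀ j, Integrable (fun a => ‖X j a - g‖ ^ 2) P)
    (hvar : ∀ j, ∫ a, ‖X j a - g‖ ^ 2 ∂P ≤ v) :
    Integrable (fun a => (1 / (M : ℝ)) • ∑ j ∈ Finset.range M, X j a) P ∧
    ∫ a, (1 / (M : ℝ)) • ∑ j ∈ Finset.range M, X j a ∂P = g ∧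
    Integrable (fun a => ‖(1 / (M : ℝ)) • ∑ j ∈ Finset.range M, X j a - g‖ ^ 2) P ∧
    ∫ a, ‖(1 / (M : ℝ)) • ∑ j ∈ Finset.range M, X j a - g‖ ^ 2 ∂P ≤ v / M := by
  have hM' : (0 : ℝ) < M := by exact_mod_cast hM
  have hrepr : ∀ a, ‖(1 / (M : ℝ)) • ∑ j ∈ Finset.range M, X j a - g‖ ^ 2
      = (1 / (M : ℝ)) ^ 2 * ∑ j ∈ Finset.range M, ∑ k ∈ Finset.range M,
        inner ℝ (X j a - g) (X k a - g) := by
    intro a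
    have h1 : (1 / (M : ℝ)) • ∑ j ∈ Finset.range M, X j a - g
        = (1 / (M : ℝ)) • ∑ j ∈ Finset.range M, (X j a - g) := by
      rw [Finset.sum_sub_distrib, smul_sub, Finset.sum_const, Finset.card_range,
        ← Nat.cast_smul_eq_nsmul ℝ, smul_smul, one_div_mul_cancel hM'.ne', one_smul]
    rw [h1, norm_smul, mul_pow, Real.norm_eq_abs, sq_abs, ← real_inner_self_eq_norm_sq, sum_inner]
    simp_rw [inner_sum]
  have hYint : ∀ j, Integrable (fun a => X j a - g) P := fun j =>
    (hint j).sub (integrable_const g)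
  have hYmean : ∀ j, ∫ a, X j a - g ∂P = 0 := fun j => by
    rw [integral_sub (hint j) (integrable_const g), hmean j]
    simp
  have hinner : ∀ j k, Integrable (fun a => inner ℝ (X j a - g) (X k a - g)) P := fun j k =>
    integrable_inner_of_sq (hYint j).1 (hYint k).1 (hsq j) (hsq k)
  have hoff : ∀ j k, j ≠ k → ∫ a, inner ℝ (X j a - g) (X k a - g) ∂P = 0 := by
    intro j k hjk
    have hI : IndepFun (fun a => X j a - g) (fun a => X k a - g) P :=
      (hind.indepFun hjk).comp (φ := fun u => u - g) (ψ := fun u => u - g)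
        (by fun_prop) (by fun_prop)
    have h : ∫ a, inner ℝ (X j a - g) (X k a - g) ∂P
        = inner ℝ (∫ a, X j a - g ∂P) (∫ a, X k a - g ∂P) :=
      hI.integral_bilin (hYint j) (hYint k) (innerSL ℝ)
    rw [h, hYmean j, inner_zero_left]
  refine ⟨(integrable_finsetSum _ fun j _ => hint j).smul _, ?_, ?_, ?_⟩
  · rw [integral_smul, integral_finsetSum _ fun j _ => hint j, Finset.sum_congr rfl
      fun j _ => hmean j, Finset.sum_const, Finset.card_range, ← Nat.cast_smul_eq_nsmul ℝ, smul_smul,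
      one_div_mul_cancel hM'.ne', one_smul]
  · simp_rw [hrepr]
    exact (integrable_finsetSum _ fun j _ => integrable_finsetSum _ fun k _ =>
      hinner j k).const_mul _
  · simp_rw [hrepr]
    rw [integral_const_mul, integral_finsetSum _ fun j _ => integrable_finsetSum _ fun k _ =>
      hinner j k]
    have h1 : ∑ j ∈ Finset.range M, ∫ a, ∑ k ∈ Finset.range M,
        inner ℝ (X j a - g) (X k a - g) ∂P ≤ ∑ j ∈ Finset.range M, v := by
      refine Finset.sum_le_sum fun j hj => ?_
      rw [integral_finsetSum _ fun k _ => hinner j k, Finset.sum_eq_single_of_mem j hj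
        fun k _ hk => hoff j k hk.symm]
      simp_rw [real_inner_self_eq_norm_sq]
      exact hvar j
    rw [Finset.sum_const, Finset.card_range, nsmul_eq_mul] at h1
    calc (1 / (M : ℝ)) ^ 2 * _ ≤ (1 / (M : ℝ)) ^ 2 * (M * v) := by gcongr
      _ = v / M := by field_simp

end Batch

/-! ### Expected total cost of a random recursion. -/

section Recursion

variable {Ω S Ξ : Type*} [MeasurableSpace S] [MeasurableSpace Ξ]

/-- The states of a recursion driven by random inputs depend measurably on the earlier inputs. -/
theorem measurable_recursion [MeasurableSpace Ω] {step : S → Ξ → S}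
    (hstep : Measurable fun q : S × Ξ => step q.1 q.2) {ξ : ℕ → Ω → Ξ} {Z : ℕ → Ω → S} {z₀ : S}
    (hZ0 : ∀ a, Z 0 a = z₀) (hZ : ∀ k a, Z (k + 1) a = step (Z k a) (ξ k a)) (k : ℕ)
    (hξ : ∀ j < k, Measurable (ξ j)) : Measurable (Z k) := by
  induction k with
  | zero =>
    rw [show Z 0 = fun _ => z₀ from funext hZ0]
    exact measurable_const
  | succ k ih =>
    rw [show Z (k + 1) = fun a => step (Z k a) (ξ k a) from funext (hZ k)]
    exact hstep.comp ((ih fun j hj => hξ j (by omega)).prodMk (hξ k (by omega)))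

variable [MeasurableSpace Ω] (P : Measure Ω) [IsProbabilityMeasure P]

/-- The expected total cost of `j` steps of a random recursion, from state `z` at time `k`. -/
def expectedCost (step : S → Ξ → S) (cost : S → Ξ → ℝ≥0∞) (ξ : ℕ → Ω → Ξ) :
    ℕ → ℕ → S → ℝ≥0∞
  | 0, _, _ => 0
  | j + 1, k, z =>
    ∫⁻ a, (cost z (ξ k a) + expectedCost step cost ξ j (k + 1) (step z (ξ k a))) ∂P

variable {P} {step : S → Ξ → S} {cost : S → Ξ → ℝ≥0∞} {ξ : ℕ → Ω → Ξ}

theorem measurable_expectedCost (hstep : Measurable fun q : S × Ξ => step q.1 q.2)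
    (hcost : Measurable fun q : S × Ξ => cost q.1 q.2) (hξ : ∀ k, Measurable (ξ k)) (j k : ℕ) :
    Measurable (expectedCost P step cost ξ j k) := by
  induction j generalizing k with
  | zero => exact measurable_const
  | succ j ih =>
    have hq : Measurable fun q : S × Ω => (q.1, ξ k q.2) :=
      measurable_fst.prodMk ((hξ k).comp measurable_snd)
    exact Measurable.lintegral_prod_right'
      (f := fun q : S × Ω => cost q.1 (ξ k q.2)
        + expectedCost P step cost ξ j (k + 1) (step q.1 (ξ k q.2)))
      ((hcost.comp hq).add ((ih (k + 1)).comp (hstep.comp hq)))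

/-- A Lyapunov function that compensates the expected cost of each step up to `b` bounds the
expected total cost of a random recursion with independent inputs. -/
theorem sum_lintegral_cost_le (hstep : Measurable fun q : S × Ξ => step q.1 q.2)
    (hcost : Measurable fun q : S × Ξ => cost q.1 q.2) (hξ : ∀ k, Measurable (ξ k))
    {Z : ℕ → Ω → S} {z₀ : S} (hZ0 : ∀ a, Z 0 a = z₀)
    (hZ : ∀ k a, Z (k + 1) a = step (Z k a) (ξ k a)) (hind : ∀ k, IndepFun (Z k) (ξ k) P)
    {C : Set S} (hz₀ : z₀ ∈ C) (hC : ∀ z ∈ C, ∀ x, step z x ∈ C) {V : S → ℝ≥0∞} {b : ℝ≥0∞}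
    (hV : ∀ k, ∀ z ∈ C, ∫⁻ a, (cost z (ξ k a) + V (step z (ξ k a))) ∂P ≤ V z + b) (K : ℕ) :
    ∑ k ∈ Finset.range K, ∫⁻ a, cost (Z k a) (ξ k a) ∂P ≤ V z₀ + K * b := by
  have hZm : ∀ k, Measurable (Z k) := fun k =>
    measurable_recursion hstep hZ0 hZ k fun j _ => hξ j
  have hub : ∀ j k, ∀ z ∈ C, expectedCost P step cost ξ j k z ≤ V z + j * b := by
    intro j
    induction j with
    | zero => intro k z _; exact bot_le
    | succ j ih =>
      intro k z hz
      calc expectedCost P step cost ξ (j + 1) k z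
          ≤ ∫⁻ a, ((cost z (ξ k a) + V (step z (ξ k a))) + j * b) ∂P := by
            refine lintegral_mono fun a => ?_
            rw [add_assoc]
            exact add_le_add_right (ih _ _ (hC z hz _)) _
        _ = ∫⁻ a, (cost z (ξ k a) + V (step z (ξ k a))) ∂P + j * b := by
            rw [lintegral_add_right _ measurable_const, lintegral_const, measure_univ, mul_one]
        _ ≤ V z + b + j * b := add_le_add_left (hV k z hz) _
        _ = V z + ((j + 1 : ℕ) : ℝ≥0∞) * b := by push_cast; ring
  -- By independence the joint law of `Z k` and `ξ k` is a product, so Tonelli's theorem does the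
  -- work of conditional expectations.
  have hrec : ∀ j k, ∫⁻ a, expectedCost P step cost ξ (j + 1) k (Z k a) ∂P
      = ∫⁻ a, cost (Z k a) (ξ k a) ∂P
        + ∫⁻ a, expectedCost P step cost ξ j (k + 1) (Z (k + 1) a) ∂P := by
    intro j k
    have hm := measurable_expectedCost (P := P) hstep hcost hξ j (k + 1)
    have hf : Measurable fun q : S × Ξ =>
        cost q.1 q.2 + expectedCost P step cost ξ j (k + 1) (step q.1 q.2) :=
      hcost.add (hm.comp hstep)
    have hpair := (hZm k).prodMk (hξ k)
    have hsum : ∫⁻ a, cost (Z k a) (ξ k a) ∂P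
        + ∫⁻ a, expectedCost P step cost ξ j (k + 1) (Z (k + 1) a) ∂P
        = ∫⁻ a, (fun q : S × Ξ => cost q.1 q.2
          + expectedCost P step cost ξ j (k + 1) (step q.1 q.2)) (Z k a, ξ k a) ∂P := by
      simp_rw [hZ]
      exact (lintegral_add_left (hcost.comp hpair) _).symm
    rw [hsum, ← lintegral_map hf hpair,
      (indepFun_iff_map_prod_eq_prod_map_map (hZm k).aemeasurable (hξ k).aemeasurable).1 (hind k)]
    have : IsProbabilityMeasure (P.map (ξ k)) := Measure.isProbabilityMeasure_map (hξ k).aemeasurable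
    rw [lintegral_prod _ hf.aemeasurable, lintegral_map hf.lintegral_prod_right' (hZm k)]
    refine lintegral_congr fun a => ?_
    exact (lintegral_map (hf.comp measurable_prodMk_left) (hξ k)).symm
  have htel : ∀ j k, ∑ i ∈ Finset.range j, ∫⁻ a, cost (Z (k + i) a) (ξ (k + i) a) ∂P
      = ∫⁻ a, expectedCost P step cost ξ j k (Z k a) ∂P := by
    intro j
    induction j with
    | zero => intro k; simp [expectedCost]
    | succ j ih =>
      intro k
      rw [hrec, ← ih (k + 1), Finset.sum_range_succ', add_comm, add_zero]
      congr 1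
      exact Finset.sum_congr rfl fun i _ => by rw [show k + (i + 1) = k + 1 + i by ring]
  have h := htel K 0
  simp only [zero_add] at h
  rw [h]
  simp_rw [hZ0]
  rw [lintegral_const, measure_univ, mul_one]
  exact hub K 0 z₀ hz₀

end Recursion

/-! ### Calculus of means and uniform random indices. -/

section HasMean

variable {Ω : Type*} [MeasurableSpace Ω] {P : Measure Ω} {f g : Ω → ℝ} {v w : ℝ}

/-- `f` is integrable with integral `v`. -/
structure HasMean (P : Measure Ω) (f : Ω → ℝ) (v : ℝ) : Prop where
  integrable : Integrable f P
  integral_eq : ∫ a, f a ∂P = v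

namespace HasMean

theorem add (hf : HasMean P f v) (hg : HasMean P g w) :
    HasMean P (fun a => f a + g a) (v + w) :=
  ⟨hf.1.add hg.1, by rw [integral_add hf.1 hg.1, hf.2, hg.2]⟩

theorem sub (hf : HasMean P f v) (hg : HasMean P g w) :
    HasMean P (fun a => f a - g a) (v - w) :=
  ⟨hf.1.sub hg.1, by rw [integral_sub hf.1 hg.1, hf.2, hg.2]⟩

theorem const_mul (c : ℝ) (hf : HasMean P f v) : HasMean P (fun a => c * f a) (c * v) :=
  ⟨hf.1.const_mul c, by rw [integral_const_mul, hf.2]⟩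

theorem const [IsProbabilityMeasure P] (c : ℝ) : HasMean P (fun _ => c) c :=
  ⟨integrable_const c, by simp⟩

theorem sum {ι : Type*} {s : Finset ι} {f : ι → Ω → ℝ} {v : ι → ℝ}
    (h : ∀ i ∈ s, HasMean P (f i) (v i)) :
    HasMean P (fun a => ∑ i ∈ s, f i a) (∑ i ∈ s, v i) :=
  ⟨integrable_finsetSum _ fun i hi => (h i hi).1, by
    rw [integral_finsetSum _ fun i hi => (h i hi).1]
    exact Finset.sum_congr rfl fun i hi => (h i hi).2⟩

end HasMean

theorem uniformOn_univ_singleton {N : ℕ} (i : Fin N) :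
    (uniformOn (Set.univ : Set (Fin N))).real {i} = 1 / N := by
  rw [Measure.real, uniformOn_univ, Measure.count_singleton, Fintype.card_fin]
  simp

/-- The mean of a random variable with a uniform random index. -/
theorem hasMean_random_index [IsProbabilityMeasure P] {N : ℕ} {S : Type*} [MeasurableSpace S]
    {I : Ω → Fin N} (hI : Measurable I) (hlaw : P.map I = uniformOn Set.univ) {Y : Ω → S}
    (hind : IndepFun I Y P) {φ : Fin N → S → ℝ} (hφ : ∀ i, Measurable (φ i)) {v : Fin N → ℝ}
    (hmean : ∀ i, HasMean P (fun a => φ i (Y a)) (v i)) :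
    HasMean P (fun a => φ (I a) (Y a)) (1 / N * ∑ i, v i) := by
  classical
  -- Decomposing over the values of `I` writes `φ (I a) (Y a)` as a sum of products of independent
  -- variables.
  let χ : Fin N → Fin N → ℝ := fun i j => if j = i then 1 else 0
  have hχ : ∀ i, HasMean P (fun a => χ i (I a)) (1 / N) := by
    intro i
    have h1 : (fun a => χ i (I a)) = (I ⁻¹' {i}).indicator 1 := by
      ext a
      simp [χ, Set.indicator_apply]
    have hm : MeasurableSet (I ⁻¹' {i}) := hI (measurableSet_singleton i)
    rw [h1]
    refine ⟨(integrable_const (1 : ℝ)).indicator hm, ?_⟩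
    rw [integral_indicator_one hm, ← map_measureReal_apply hI (measurableSet_singleton i), hlaw,
      uniformOn_univ_singleton]
  have hprod : ∀ i, HasMean P (fun a => χ i (I a) * φ i (Y a)) (1 / N * v i) := by
    intro i
    have hi : IndepFun (fun a => χ i (I a)) (fun a => φ i (Y a)) P :=
      hind.comp (φ := χ i) (ψ := φ i) (measurable_of_finite _) (hφ i)
    refine ⟨hi.integrable_mul (hχ i).1 (hmean i).1, ?_⟩
    rw [hi.integral_fun_mul_eq_mul_integral (hχ i).1.1 (hmean i).1.1, (hχ i).2, (hmean i).2]
  have hrepr : (fun a => φ (I a) (Y a)) = fun a => ∑ i, χ i (I a) * φ i (Y a) := by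
    ext a
    simp [χ]
  rw [hrepr, Finset.mul_sum]
  exact HasMean.sum fun i _ => hprod i

end HasMean

/-! ### Expected Lyapunov decrease in one iteration. -/

namespace Problem

variable {N : ℕ} {n : Fin N → ℕ} {m : ℕ} {D : Problem n m} {L : ℝ≥0} {μ Fbar ρ η τ : ℝ}
variable {Ω : Type*} [MeasurableSpace Ω] {P : Measure Ω}

/-- `sx` and `sy` are unbiased estimates of the partial gradients of `f` at `z`, with variance at
most `vx` for each primal block and at most `vy` for the dual variable. -/
structure UnbiasedAt (D : Problem n m) (P : Measure Ω) (z : Joint n m) (sx : Ω → Primal n)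
    (sy : Ω → Dual m) (vx vy : ℝ) : Prop where
  integrable_x : ∀ i, Integrable (fun a => sx a i) P
  integrable_y : Integrable sy P
  mean_x : ∀ i, ∫ a, sx a i ∂P = (∇ D.f z).fst i
  mean_y : ∫ a, sy a ∂P = (∇ D.f z).snd
  integrable_sq_x : ∀ i, Integrable (fun a => ‖sx a i - (∇ D.f z).fst i‖ ^ 2) P
  integrable_sq_y : Integrable (fun a => ‖sy a - (∇ D.f z).snd‖ ^ 2) P
  var_x : ∀ i, ∫ a, ‖sx a i - (∇ D.f z).fst i‖ ^ 2 ∂P ≤ vx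
  var_y : ∫ a, ‖sy a - (∇ D.f z).snd‖ ^ 2 ∂P ≤ vy

theorem hasMean_inner_zero [IsProbabilityMeasure P] {E : Type*} [NormedAddCommGroup E]
    [InnerProductSpace ℝ E] [CompleteSpace E] {s : Ω → E} (hs : Integrable s P) {g : E}
    (hg : ∫ a, s a ∂P = g) (w : E) : HasMean P (fun a => inner ℝ (s a - g) w) 0 := by
  have hsub : Integrable (fun a => s a - g) P := hs.sub (integrable_const g)
  refine ⟨hsub.inner_const w, ?_⟩
  simp_rw [real_inner_comm w]
  rw [integral_inner hsub, integral_sub hs (integrable_const g), hg]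
  simp

namespace Regular

theorem continuous_block_prox (hD : D.Regular L μ Fbar) (hτ : 0 < τ) {z : Joint n m}
    (hz : z ∈ D.feasible) (j : Fin N) :
    Continuous fun s : Primal n => prox τ (D.g j) (z.fst j - τ • s j) :=
  (continuous_prox (hD.closedConvex_g j) ⟨_, hD.mem_effDom_gSum.1 hz.1 j⟩ hτ).comp
    (by fun_prop)

theorem measurable_stepBound (hD : D.Regular L μ Fbar) (hτ : 0 < τ) {z : Joint n m}
    (hz : z ∈ D.feasible) (i : Fin N) :
    Measurable fun q : Primal n × Dual m => D.stepBound μ ρ η τ z i q.1 q.2 := by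
  have hc : ∀ j, Continuous fun q : Primal n × Dual m =>
      ‖prox τ (D.g j) (z.fst j - τ • q.1 j) - z.fst j‖ ^ 2 := fun j =>
    ((((hD.continuous_block_prox hτ hz j).comp continuous_fst).sub continuous_const).norm).pow 2
  have hs : Continuous fun q : Primal n × Dual m =>
      ∑ j, ‖prox τ (D.g j) (z.fst j - τ • q.1 j) - z.fst j‖ ^ 2 :=
    continuous_finsetSum _ fun j _ => hc j
  refine Continuous.measurable ?_
  unfold stepBound
  refine Continuous.add (Continuous.add (Continuous.add (Continuous.sub (Continuous.add
    (Continuous.add (continuous_const.mul (hc i)) (continuous_const.mul hs)) ?_) ?_) ?_) ?_) ?_ <;>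
  fun_prop

/-- At fixed `z` the vectors paired with the noise are deterministic, so unbiasedness turns both
inner products into the zeros of the formula. Each term involves `sx` alone or `sy` alone, so their
joint law does not enter. -/
theorem hasMean_stepBound [IsProbabilityMeasure P] (hD : D.Regular L μ Fbar) (hτ : 0 < τ)
    {z : Joint n m} (hz : z ∈ D.feasible) {sx : Ω → Primal n} {sy : Ω → Dual m} {vx vy : ℝ}
    (hsx : Measurable sx) (hs : D.UnbiasedAt P z sx sy vx vy) (i : Fin N) :
    HasMean P (fun a => D.stepBound μ ρ η τ z i (sx a) (sy a))
      (-(1 / (4 * τ)) * ∫ a, ‖prox τ (D.g i) (z.fst i - τ • sx a i) - z.fst i‖ ^ 2 ∂P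
        + 1 / (4 * N * τ) *
          ∑ j, ∫ a, ‖prox τ (D.g j) (z.fst j - τ • sx a j) - z.fst j‖ ^ 2 ∂P
        + τ / 2 * ‖((∇ D.f (pair z.fst (D.dualSol z.fst))).fst - (∇ D.f z).fst) i‖ ^ 2
        - 2 * ρ * μ ^ 2 * η * ‖z.snd - D.dualSol z.fst‖ ^ 2 + 0
        + τ * ∫ a, ‖sx a i - (∇ D.f z).fst i‖ ^ 2 ∂P
        + η * ρ * μ * (μ * η + 6 * ((2 - μ * η) / (1 - μ * η))) *
          (0 + η * ∫ a, ‖sy a - (∇ D.f z).snd‖ ^ 2 ∂P)) := by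
  have hprox : ∀ j, HasMean P
      (fun a => ‖prox τ (D.g j) (z.fst j - τ • sx a j) - z.fst j‖ ^ 2)
      (∫ a, ‖prox τ (D.g j) (z.fst j - τ • sx a j) - z.fst j‖ ^ 2 ∂P) := by
    intro j
    refine ⟨?_, rfl⟩
    set p := prox τ (D.g j) (z.fst j - τ • (∇ D.f z).fst j)
    -- The displacement differs from the noise-free one by at most `τ` times the noise, which gives
    -- an integrable majorant.
    refine (((hs.integrable_sq_x j).const_mul (2 * τ ^ 2)).add
      (integrable_const (2 * ‖p - z.fst j‖ ^ 2))).mono' ?_ (Filter.Eventually.of_forall fun a => ?_)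
    · exact (((((hD.continuous_block_prox hτ hz j).sub
        continuous_const).norm).pow 2).measurable.comp hsx).aestronglyMeasurable
    · have h1 := norm_prox_sub_prox_le (hD.closedConvex_g j)
        ⟨_, hD.mem_effDom_gSum.1 hz.1 j⟩ hτ (z.fst j - τ • sx a j)
        (z.fst j - τ • (∇ D.f z).fst j)
      rw [sub_sub_sub_cancel_left, ← smul_sub, norm_smul, Real.norm_of_nonneg hτ.le,
        norm_sub_rev] at h1
      rw [Pi.add_apply, Real.norm_of_nonneg (sq_nonneg _)]
      set r := prox τ (D.g j) (z.fst j - τ • sx a j)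
      set e := ‖sx a j - (∇ D.f z).fst j‖
      rw [norm_sub_rev ((∇ D.f z).fst j)] at h1
      rw [norm_sub_rev p r] at h1
      have h2 : ‖r - z.fst j‖ ≤ ‖r - p‖ + ‖p - z.fst j‖ := norm_sub_le_norm_sub_add_norm_sub _ _ _
      have h3 : ‖r - z.fst j‖ ≤ τ * e + ‖p - z.fst j‖ := h2.trans (add_le_add_left h1 _)
      have h4 := pow_le_pow_left₀ (norm_nonneg _) h3 2
      nlinarith [sq_nonneg (τ * e - ‖p - z.fst j‖)]
  have hex : HasMean P (fun a => inner ℝ ((∇ D.f z).fst i - sx a i)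
      (prox τ (D.g i) (z.fst i - τ • (∇ D.f z).fst i) - z.fst i)) 0 := by
    have h := (hasMean_inner_zero (hs.integrable_x i) (hs.mean_x i)
      (prox τ (D.g i) (z.fst i - τ • (∇ D.f z).fst i) - z.fst i)).const_mul (-1)
    simp only [neg_one_mul, ← inner_neg_left, neg_sub, neg_zero] at h
    exact h
  have he2x : HasMean P (fun a => ‖(∇ D.f z).fst i - sx a i‖ ^ 2)
      (∫ a, ‖sx a i - (∇ D.f z).fst i‖ ^ 2 ∂P) := by
    simp_rw [norm_sub_rev _ (sx _ i)]
    exact ⟨hs.integrable_sq_x i, rfl⟩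
  have hey := hasMean_inner_zero hs.integrable_y hs.mean_y
    (prox η D.h (z.snd + η • (∇ D.f z).snd) - D.dualSol z.fst)
  have he2y : HasMean P (fun a => ‖sy a - (∇ D.f z).snd‖ ^ 2)
      (∫ a, ‖sy a - (∇ D.f z).snd‖ ^ 2 ∂P) := ⟨hs.integrable_sq_y, rfl⟩
  exact (((((((hprox i).const_mul _).add ((HasMean.sum fun j _ => hprox j).const_mul _)).add
    (HasMean.const _)).sub (HasMean.const _)).add hex).add (he2x.const_mul τ)).add
    ((hey.add (he2y.const_mul η)).const_mul _)

/-- The expected change of the Lyapunov function in one iteration. -/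
theorem lintegral_lyapunov_step [IsProbabilityMeasure P] (hD : D.Regular L μ Fbar)
    (h : AdmissibleSteps N L μ ρ η τ) {z : Joint n m} (hz : z ∈ D.feasible) {I : Ω → Fin N}
    (hI : Measurable I) (hlaw : P.map I = uniformOn Set.univ) {sx : Ω → Primal n}
    {sy : Ω → Dual m} (hsx : Measurable sx)
    (hind : IndepFun I (fun a => (sx a, sy a)) P) {vx vy : ℝ}
    (hs : D.UnbiasedAt P z sx sy vx vy) :
    ∫⁻ a, (ENNReal.ofReal (τ / (4 * N) * ‖D.proxGradMap η τ z (sx a) (sy a)‖ ^ 2)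
        + ENNReal.ofReal (D.lyapunov μ ρ (D.blockStep η τ z (I a) (sx a) (sy a)) - Fbar)) ∂P
      ≤ ENNReal.ofReal (D.lyapunov μ ρ z - Fbar)
        + ENNReal.ofReal (τ * vx
          + η ^ 2 * ρ * μ * (μ * η + 6 * ((2 - μ * η) / (1 - μ * η))) * vy) := by
  have hτ := h.τ_pos
  have hN : (0 : ℝ) < N := by exact_mod_cast h.N_pos
  have hρ := h.ρ_pos
  have hμ := h.μ_pos
  have hη := h.η_pos
  have hlow : ∀ w ∈ D.feasible, 0 ≤ D.lyapunov μ ρ w - Fbar := by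
    intro w hw
    have h1 := hD.Fbar_le_primalReal hμ hw.1
    have h2 : 0 ≤ 6 * ρ * μ * ‖w.snd - D.dualSol w.fst‖ ^ 2 := by positivity
    rw [lyapunov]
    linarith
  have hmean := hasMean_random_index hI hlaw hind
    (φ := fun i q => D.stepBound μ ρ η τ z i q.1 q.2)
    (fun i => hD.measurable_stepBound hτ hz i)
    (fun i => hD.hasMean_stepBound (P := P) (ρ := ρ) (η := η) hτ hz hsx hs i)
  have hmean' := (HasMean.const (P := P) (D.lyapunov μ ρ z - Fbar)).add hmean
  have hcost : ∀ a, 0 ≤ τ / (4 * N) * ‖D.proxGradMap η τ z (sx a) (sy a)‖ ^ 2 := fun a => by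
    positivity
  have hstep : ∀ a, τ / (4 * N) * ‖D.proxGradMap η τ z (sx a) (sy a)‖ ^ 2
      + (D.lyapunov μ ρ (D.blockStep η τ z (I a) (sx a) (sy a)) - Fbar)
      ≤ D.lyapunov μ ρ z - Fbar + D.stepBound μ ρ η τ z (I a) (sx a) (sy a) := fun a => by
    linarith [hD.lyapunov_step h hz (I a) (sx a) (sy a)]
  have hnext : ∀ a, 0 ≤ D.lyapunov μ ρ (D.blockStep η τ z (I a) (sx a) (sy a)) - Fbar :=
    fun a => hlow _ (hD.blockStep_mem hτ hη hz _ _ _)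
  calc _ ≤ ∫⁻ a, ENNReal.ofReal (D.lyapunov μ ρ z - Fbar
          + D.stepBound μ ρ η τ z (I a) (sx a) (sy a)) ∂P := by
        refine lintegral_mono fun a => ?_
        rw [← ENNReal.ofReal_add (hcost a) (hnext a)]
        exact ENNReal.ofReal_le_ofReal (hstep a)
    _ = ENNReal.ofReal (∫ a, D.lyapunov μ ρ z - Fbar
          + D.stepBound μ ρ η τ z (I a) (sx a) (sy a) ∂P) :=
        (ofReal_integral_eq_lintegral_ofReal hmean'.1 (Filter.Eventually.of_forall fun a =>
          (add_nonneg (hcost a) (hnext a)).trans (hstep a))).symm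
    _ ≤ ENNReal.ofReal (D.lyapunov μ ρ z - Fbar + (τ * vx
          + η ^ 2 * ρ * μ * (μ * η + 6 * ((2 - μ * η) / (1 - μ * η))) * vy)) := by
        refine ENNReal.ofReal_le_ofReal ?_
        rw [hmean'.2]
        refine add_le_add_right ?_ _
        -- In the average over the blocks the squared displacements cancel: each block counts
        -- `-1/(4τ)` with probability `1/N` against a sure `1/(4Nτ)`.
        rw [one_div_mul_eq_div, div_le_iff₀ hN]
        have h1 := hD.sum_norm_gradX_sub_sq_le hμ hz
        have h2 : ∑ i, ∫ a, ‖sx a i - (∇ D.f z).fst i‖ ^ 2 ∂P ≤ ∑ _i : Fin N, vx :=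
          Finset.sum_le_sum fun i _ => hs.var_x i
        simp only [Finset.sum_add_distrib, Finset.sum_sub_distrib, ← Finset.mul_sum,
          Finset.sum_const, Finset.card_univ, Fintype.card_fin, nsmul_eq_mul] at h1 h2 ⊢
        set B := η * ρ * μ * (μ * η + 6 * ((2 - μ * η) / (1 - μ * η))) with hB
        have hB0 : 0 ≤ B := by
          have h3 : 0 < 1 - μ * η := by linarith [h.μη_lt_one]
          have h4 : 0 < 2 - μ * η := by linarith
          positivity
        have hB2 : η ^ 2 * ρ * μ * (μ * η + 6 * ((2 - μ * η) / (1 - μ * η))) = B * η := by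
          rw [hB]; ring
        rw [hB2]
        have h5 := mul_le_mul_of_nonneg_left hs.var_y (show 0 ≤ N * (B * η) by positivity)
        have h6 := mul_le_mul_of_nonneg_left h2 hτ.le
        have h7 := mul_le_mul_of_nonneg_left h1 (show 0 ≤ τ / 2 by positivity)
        set δ := ‖z.snd - D.dualSol z.fst‖ ^ 2
        have hδ : 0 ≤ δ := sq_nonneg _
        -- By `τ = Nρμ²η³` and `Lη ≤ 1`, the surplus of `δ` covers the primal gradient mismatch.
        have h8 : τ / 2 * ((L : ℝ) ^ 2 * δ) ≤ N * (2 * ρ * μ ^ 2 * η * δ) := by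
          have h9 : (L * η) ^ 2 ≤ (1 : ℝ) ^ 2 :=
            pow_le_pow_left₀ (mul_nonneg h.L_nonneg hη.le) h.Lη_le_one 2
          have h10 : τ / 2 * ((L : ℝ) ^ 2 * δ) = N * ρ * μ ^ 2 * η * δ / 2 * (L * η) ^ 2 := by
            rw [h.τ_eq]; ring
          have h11 := mul_le_mul_of_nonneg_left h9
            (show 0 ≤ N * ρ * μ ^ 2 * η * δ / 2 by positivity)
          have h12 : 0 ≤ N * ρ * μ ^ 2 * η * δ := by positivity
          linarith
        have h13 : ∀ s : ℝ, 1 / (4 * N * τ) * (N * s) = 1 / (4 * τ) * s := by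
          intro s; field_simp
        rw [h13]
        linarith
    _ ≤ _ := ENNReal.ofReal_add_le

end Regular

end Problem

/-! ### Independence of events built from disjoint groups of draws. -/

section Independence

variable {Ω ι κ : Type*} [mΩ : MeasurableSpace Ω] {P : Measure Ω}

/-- Events that depend on disjoint groups of independent σ-algebras are independent. -/
theorem measure_biInter_of_label [IsProbabilityMeasure P] {σ : ι → MeasurableSpace Ω}
    (hle : ∀ i, σ i ≤ mΩ)
    (hind : iIndep σ P) (label : ι → κ) {E : κ → Set Ω}
    (hE : ∀ s, MeasurableSet[⨆ i ∈ label ⁻¹' {s}, σ i] (E s)) (F : Finset κ) :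
    P (⋂ s ∈ F, E s) = ∏ s ∈ F, P (E s) := by
  classical
  induction F using Finset.induction_on with
  | empty => simp
  | insert s F hs ih =>
    have hdisj : Disjoint (label ⁻¹' {s}) (label ⁻¹' (F : Set κ)) :=
      Disjoint.preimage _ (by simpa using hs)
    have h := (Indep_iff _ _ _).1 (indep_iSup_of_disjoint hle hind hdisj) (E s) (⋂ u ∈ F, E u)
      (hE s) (by
        refine Finset.measurableSet_biInter F fun u hu => ?_
        refine (iSup₂_le fun i hi => ?_ : ⨆ i ∈ label ⁻¹' {u}, σ i ≤ _) _ (hE u)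
        have hi' : label i = u := hi
        exact le_iSup₂_of_le i (by simpa [hi'] using hu) le_rfl)
    rw [Finset.set_biInter_insert, h, ih, Finset.prod_insert hs]

end Independence

/-! ### Consequences of the parameter choices. -/

namespace Input

variable {N : ℕ} {n : Fin N → ℕ} {m : ℕ} {A : Input n m} {D : Problem n m}

theorem lipEst_eq (A : Input n m) (ℓ : ℕ) : A.lipEst ℓ = A.μ / A.γ ^ ℓ := by
  induction ℓ with
  | zero => simp [lipEst]
  | succ ℓ ih => rw [lipEst, ih, div_div, pow_succ]

theorem etaY_eq (A : Input n m) (ℓ : ℕ) : A.etaY ℓ = A.γ ^ ℓ / A.μ := by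
  rw [etaY, lipEst_eq, one_div_div]

theorem rho_pos (hN : 1 ≤ N) (A : Input n m) : 0 < A.rho := by
  have hN' : (0 : ℝ) < N := by exact_mod_cast hN
  have h1 : 1 < Real.sqrt (1 + 12 / (N : ℝ)) := by
    rw [Real.lt_sqrt zero_le_one]
    have : 0 < 12 / (N : ℝ) := by positivity
    linarith
  rw [rho]
  linarith

/-- `ρ` is the positive root of `48Nρ² + 4Nρ = 1`; later arguments use only this equation and
positivity. -/
theorem rho_eq (hN : 1 ≤ N) (A : Input n m) : 4 * N * A.rho * (12 * A.rho + 1) = 1 := by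
  have hN' : (0 : ℝ) < N := by exact_mod_cast hN
  have h1 : Real.sqrt (1 + 12 / (N : ℝ)) ^ 2 = 1 + 12 / (N : ℝ) :=
    Real.sq_sqrt (by positivity)
  rw [rho]
  set s := Real.sqrt (1 + 12 / (N : ℝ))
  have h2 : 4 * (N : ℝ) * ((s - 1) / 24) * (12 * ((s - 1) / 24) + 1) = N * (s ^ 2 - 1) / 12 := by
    ring
  rw [h2, h1]
  field_simp
  norm_num

/-- Rounds start at `1`, which makes `μ η_y = γ^ℓ` strictly less than `1`; the factors `1/(1 - μ
η_y)` depend on this. -/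
theorem Valid.admissibleSteps (hA : A.Valid D) (hN : 1 ≤ N) {L : ℝ≥0} {ℓ : ℕ} (hℓ : 1 ≤ ℓ)
    (hL : L * A.etaY ℓ ≤ 1) : AdmissibleSteps N L A.μ A.rho (A.etaY ℓ) (A.etaX ℓ) where
  N_pos := hN
  L_nonneg := L.2
  μ_pos := hA.μ_pos
  ρ_pos := A.rho_pos hN
  η_pos := by
    rw [etaY_eq]
    exact div_pos (pow_pos hA.γ_pos _) hA.μ_pos
  μη_lt_one := by
    rw [etaY_eq, mul_div_cancel₀ _ hA.μ_pos.ne']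
    exact pow_lt_one₀ hA.γ_pos.le hA.γ_lt_one (by omega)
  Lη_le_one := hL
  ρ_eq := A.rho_eq hN
  τ_eq := rfl

theorem Valid.etaY_pos (hA : A.Valid D) (ℓ : ℕ) : 0 < A.etaY ℓ := by
  rw [etaY_eq]
  exact div_pos (pow_pos hA.γ_pos _) hA.μ_pos

theorem Valid.etaX_pos (hA : A.Valid D) (hN : 1 ≤ N) (ℓ : ℕ) : 0 < A.etaX ℓ := by
  have h1 := A.rho_pos hN
  have h2 := hA.etaY_pos ℓ
  have h3 := hA.μ_pos
  have hN' : (0 : ℝ) < N := by exact_mod_cast hN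
  rw [etaX]
  positivity

theorem obj_eq {L : ℝ≥0} {μ Fbar : ℝ} (hD : D.Regular L μ Fbar) {x : Primal n} {y : Dual m}
    (hx : x ∈ effDom D.gSum) (hy : y ∈ effDom D.h) : D.obj x y
      = ((∑ i, (D.g i (x i)).toReal + D.f (pair x y) - (D.h y).toReal : ℝ) : EReal) := by
  rw [Problem.obj, hD.gSum_eq hx, ← hD.closedConvex_h.coe_toReal hy, EReal.coe_sub,
    EReal.coe_add, EReal.toReal_coe]

theorem Valid.primalReal_le (hA : A.Valid D) {L : ℝ≥0} (hD : D.Regular L A.μ A.Fbar) :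
    D.primalReal A.x0 ≤ (D.obj A.x0 A.y0).toReal + A.εtilde := by
  have hsol := hD.dualSol_mem hA.μ_pos ⟨_, hA.y0_mem⟩ hA.x0_mem
  have h1 := (le_iSup (fun y => D.obj A.x0 y) (D.dualSol A.x0)).trans hA.y0_accurate
  simp only [obj_eq hD hA.x0_mem hsol, obj_eq hD hA.x0_mem hA.y0_mem] at h1
  rw [obj_eq hD hA.x0_mem hA.y0_mem, EReal.toReal_coe, Problem.primalReal, Problem.phiReal]
  have h2 : ∑ i, (D.g i (A.x0 i)).toReal + D.f (pair A.x0 (D.dualSol A.x0))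
      - (D.h (D.dualSol A.x0)).toReal ≤ ∑ i, (D.g i (A.x0 i)).toReal + D.f (pair A.x0 A.y0)
      - (D.h A.y0).toReal + A.εtilde := by exact_mod_cast h1
  linarith

/-- The right-hand side `𝓛(x⁰, y⁰) - F̄ + (12ρ + 1) ε̃` in the choice of the iteration number bounds
the initial Lyapunov gap. -/
theorem Valid.lyapunov_le (hA : A.Valid D) (hN : 1 ≤ N) {L : ℝ≥0} (hD : D.Regular L A.μ A.Fbar) :
    D.lyapunov A.μ A.rho (pair A.x0 A.y0) ≤
      (D.obj A.x0 A.y0).toReal + (12 * A.rho + 1) * A.εtilde := by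
  have h1 := hA.primalReal_le hD
  have h3 := hD.dual_growth hA.μ_pos hA.x0_mem hA.y0_mem
  rw [Problem.lyapunov]
  simp only [WithLp.toLp_fst, WithLp.toLp_snd]
  rw [obj_eq hD hA.x0_mem hA.y0_mem, EReal.toReal_coe] at h1 ⊢
  rw [Problem.primalReal] at h1 ⊢
  -- Quadratic growth turns the accuracy of `y⁰` into a distance. Multiplied by `6ρ` this is the
  -- part `12ρ ε̃`; the remaining `ε̃` bounds `F(x⁰) - 𝓛(x⁰, y⁰)`.
  have h4 : A.μ * ‖A.y0 - D.dualSol A.x0‖ ^ 2 ≤ 2 * A.εtilde := by linarith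
  have h5 := mul_le_mul_of_nonneg_left h4 (show 0 ≤ 6 * A.rho by linarith [A.rho_pos hN])
  linarith

/-- The factor `64N/(ε²η_x)` in `K` is the inverse of `η_x/(4N) · ε²/16`, so the initial gap uses
half of the budget `ε²/8` per iteration. -/
theorem Valid.gap_le (hA : A.Valid D) (hN : 1 ≤ N) (ℓ : ℕ) :
    (D.obj A.x0 A.y0).toReal - A.Fbar + (12 * A.rho + 1) * A.εtilde
      ≤ A.numIter D ℓ * (A.etaX ℓ / (4 * N) * (A.ε ^ 2 / 16)) := by
  have h : 64 * N / (A.ε ^ 2 * A.etaX ℓ) * ((D.obj A.x0 A.y0).toReal - A.Fbar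
      + (12 * A.rho + 1) * A.εtilde) ≤ A.numIter D ℓ := Nat.le_ceil _
  have h1 := hA.etaX_pos hN ℓ
  have h2 := hA.ε_pos
  have hN' : (0 : ℝ) < N := by exact_mod_cast hN
  rw [div_mul_eq_mul_div, div_le_iff₀ (by positivity)] at h
  have h3 : A.numIter D ℓ * (A.etaX ℓ / (4 * N) * (A.ε ^ 2 / 16))
      = A.numIter D ℓ * (A.ε ^ 2 * A.etaX ℓ) / (64 * N) := by
    field_simp
    ring
  rw [h3, le_div_iff₀ (by positivity)]
  linarith

/-- Needed to cancel `K` against the weight `1/K` of the returned index. Strictness comes from `12ρ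
ε̃ > 0`, since `𝓛(x⁰, y⁰) + ε̃ ≥ F(x⁰) ≥ F̄`. -/
theorem Valid.numIter_pos (hA : A.Valid D) (hN : 1 ≤ N) {L : ℝ≥0} (hD : D.Regular L A.μ A.Fbar)
    (ℓ : ℕ) : 0 < A.numIter D ℓ := by
  have h1 := hA.primalReal_le hD
  have h2 := hD.Fbar_le_primalReal hA.μ_pos hA.x0_mem
  have h3 := mul_pos (A.rho_pos hN) hA.εtilde_pos
  have h4 : 0 < (D.obj A.x0 A.y0).toReal - A.Fbar + (12 * A.rho + 1) * A.εtilde := by linarith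
  rw [numIter, Nat.ceil_pos]
  have h5 := hA.etaX_pos hN ℓ
  have h6 := hA.ε_pos
  have hN' : (0 : ℝ) < N := by exact_mod_cast hN
  positivity

theorem Valid.batchSizeX_pos (A : Input n m) : 0 < A.batchSizeX := by
  rw [batchSizeX, Nat.ceil_pos]
  positivity

theorem Valid.noiseX_le (hA : A.Valid D) :
    A.σx ^ 2 / A.batchSizeX ≤ A.ε ^ 2 / 128 := by
  have h := Nat.le_ceil (128 / A.ε ^ 2 * A.σx ^ 2 + 1)
  have h0 : (0 : ℝ) < A.batchSizeX := by exact_mod_cast Valid.batchSizeX_pos A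
  rw [← batchSizeX] at h
  have hε := hA.ε_pos
  rw [div_le_iff₀ h0]
  have h1 : 128 / A.ε ^ 2 * A.σx ^ 2 ≤ A.batchSizeX := by linarith
  rw [div_mul_eq_mul_div, div_le_iff₀ (by positivity)] at h1
  linarith

/-- The prefactor is the weight of the dual variance in the Lyapunov inequality once `η_x/N` is
factored out. Primal and dual noise are each allotted `ε²/128`. -/
theorem Valid.noiseY_le (hA : A.Valid D) {ℓ : ℕ} (hc : A.μ * A.etaY ℓ < 1) :
    0 < A.batchSizeY ℓ ∧
    (1 + 6 / (A.μ * A.etaY ℓ) * ((2 - A.μ * A.etaY ℓ) / (1 - A.μ * A.etaY ℓ)))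
      * (A.σy ^ 2 / A.batchSizeY ℓ) ≤ A.ε ^ 2 / 128 := by
  have hc0 : 0 < A.μ * A.etaY ℓ := mul_pos hA.μ_pos (hA.etaY_pos ℓ)
  have hε := hA.ε_pos
  rw [batchSizeY]
  set c := A.μ * A.etaY ℓ
  have h1 : 0 < 1 - c := by linarith
  have h2 : 0 < 2 - c := by linarith
  set C := 1 + 6 / c * ((2 - c) / (1 - c))
  have hC : 0 ≤ C := by positivity
  have h := Nat.le_ceil (C * (128 / A.ε ^ 2) * A.σy ^ 2 + 1)
  have hpos : 0 < ⌈C * (128 / A.ε ^ 2) * A.σy ^ 2 + 1⌉₊ := Nat.ceil_pos.2 (by positivity)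
  refine ⟨hpos, ?_⟩
  have h0 : (0 : ℝ) < ⌈C * (128 / A.ε ^ 2) * A.σy ^ 2 + 1⌉₊ := by exact_mod_cast hpos
  rw [← mul_div_assoc, div_le_iff₀ h0]
  have h3 : C * (128 / A.ε ^ 2) * A.σy ^ 2
      ≤ (⌈C * (128 / A.ε ^ 2) * A.σy ^ 2 + 1⌉₊ : ℝ) := by linarith
  set M : ℝ := (⌈C * (128 / A.ε ^ 2) * A.σy ^ 2 + 1⌉₊ : ℝ)
  rw [mul_div_assoc', div_mul_eq_mul_div, div_le_iff₀ (by positivity)] at h3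
  linarith

theorem Valid.numRuns_pos (hA : A.Valid D) : 0 < A.numRuns := by
  rw [numRuns, Nat.ceil_pos]
  exact Real.logb_pos one_lt_two (by
    rw [lt_div_iff₀ hA.p_pos]
    linarith [hA.p_lt_one])

theorem Valid.half_pow_numRuns_le (hA : A.Valid D) : (1 / 2 : ℝ) ^ A.numRuns ≤ A.p := by
  have h := Nat.le_ceil (Real.logb 2 (1 / A.p))
  rw [← numRuns, Real.logb_le_iff_le_rpow one_lt_two (by have := hA.p_pos; positivity),
    Real.rpow_natCast, div_le_iff₀ hA.p_pos] at h
  rw [one_div_pow, div_le_iff₀ (by positivity)]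
  linarith

end Input

/-! ### Measurability and independence of the draws. -/

section Draws

variable {N : ℕ} {n : Fin N → ℕ} {m : ℕ} {Ξx Ξy Ω : Type*}

section Measurability

variable {D : Problem n m} {O : Oracle n m Ξx Ξy}

theorem batchX_apply (O : Oracle n m Ξx Ξy) (M : ℕ) (ω : ℕ → Ξx) (z : Joint n m) (i : Fin N) :
    batchX O M ω z i = (1 / (M : ℝ)) • ∑ j ∈ Finset.range M, O.gradX z (ω j) i := by
  simp [batchX]

theorem measurable_batchX [MeasurableSpace Ξx]
    (hO : Measurable fun q : Joint n m × Ξx => O.gradX q.1 q.2) (M : ℕ) :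
    Measurable fun q : Joint n m × (ℕ → Ξx) => batchX O M q.2 q.1 := by
  have h : Measurable fun q : Joint n m × (ℕ → Ξx) =>
      ∑ j ∈ Finset.range M, O.gradX q.1 (q.2 j) := Finset.measurable_sum _ fun j _ =>
    hO.comp (measurable_fst.prodMk ((measurable_pi_apply j).comp measurable_snd))
  exact h.const_smul (1 / (M : ℝ))

theorem measurable_batchY [MeasurableSpace Ξy]
    (hO : Measurable fun q : Joint n m × Ξy => O.gradY q.1 q.2) (M : ℕ) :
    Measurable fun q : Joint n m × (ℕ → Ξy) => batchY O M q.2 q.1 := by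
  have h : Measurable fun q : Joint n m × (ℕ → Ξy) =>
      ∑ j ∈ Finset.range M, O.gradY q.1 (q.2 j) := Finset.measurable_sum _ fun j _ =>
    hO.comp (measurable_fst.prodMk ((measurable_pi_apply j).comp measurable_snd))
  exact h.const_smul (1 / (M : ℝ))

/-- The step of RB-SGDA as a function of the state and of the random draws. -/
def drawStep (D : Problem n m) (O : Oracle n m Ξx Ξy) (η τ : ℝ) (Mx My : ℕ) (z : Joint n m)
    (ξ : Fin N × ((ℕ → Ξx) × (ℕ → Ξy))) : Joint n m :=
  D.blockStep η τ z ξ.1 (batchX O Mx ξ.2.1 z) (batchY O My ξ.2.2 z)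

/-- The gradient map of RB-SGDA as a function of the state and of the random draws. -/
def drawGradMap (D : Problem n m) (O : Oracle n m Ξx Ξy) (η τ : ℝ) (Mx My : ℕ) (z : Joint n m)
    (ξ : Fin N × ((ℕ → Ξx) × (ℕ → Ξy))) : Joint n m :=
  D.proxGradMap η τ z (batchX O Mx ξ.2.1 z) (batchY O My ξ.2.2 z)

theorem measurable_blockStep {η τ : ℝ} (hg : ∀ i, Measurable (prox τ (D.g i)))
    (hh : Measurable (prox η D.h)) (i : Fin N) :
    Measurable fun q : Joint n m × Primal n × Dual m => D.blockStep η τ q.1 i q.2.1 q.2.2 := by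
  unfold Problem.blockStep Problem.setBlock
  refine (WithLp.measurable_toLp 2 _).comp (Measurable.prodMk ?_ ?_)
  · refine (WithLp.measurable_toLp 2 _).comp (measurable_pi_iff.2 fun j => ?_)
    by_cases hj : j = i
    · subst hj
      simp only [Function.update_self]
      exact (hg j).comp (by fun_prop)
    · simp only [Function.update_of_ne hj]
      fun_prop
  · exact hh.comp (by fun_prop)

theorem measurable_proxGradMap {η τ : ℝ} (hg : ∀ i, Measurable (prox τ (D.g i)))
    (hh : Measurable (prox η D.h)) :
    Measurable fun q : Joint n m × Primal n × Dual m => D.proxGradMap η τ q.1 q.2.1 q.2.2 := by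
  unfold Problem.proxGradMap
  refine (WithLp.measurable_toLp 2 _).comp (Measurable.prodMk ?_ ?_)
  · refine (WithLp.measurable_toLp 2 _).comp (measurable_pi_iff.2 fun j => ?_)
    have h1 : Measurable fun q : Joint n m × Primal n × Dual m => q.1.fst j := by fun_prop
    have h2 : Measurable fun q : Joint n m × Primal n × Dual m =>
        prox τ (D.g j) (q.1.fst j - τ • q.2.1 j) := (hg j).comp (by fun_prop)
    exact (h1.sub h2).const_smul (1 / τ)
  · have h1 : Measurable fun q : Joint n m × Primal n × Dual m => q.1.snd := by fun_prop
    have h2 : Measurable fun q : Joint n m × Primal n × Dual m =>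
        prox η D.h (q.1.snd + η • q.2.2) := hh.comp (by fun_prop)
    exact (h2.sub h1).const_smul (1 / η)

variable [MeasurableSpace Ξx] [MeasurableSpace Ξy]

theorem measurable_batches (hOx : Measurable fun q : Joint n m × Ξx => O.gradX q.1 q.2)
    (hOy : Measurable fun q : Joint n m × Ξy => O.gradY q.1 q.2) (Mx My : ℕ) :
    Measurable fun q : Joint n m × (Fin N × ((ℕ → Ξx) × (ℕ → Ξy))) =>
      (q.1, batchX O Mx q.2.2.1 q.1, batchY O My q.2.2.2 q.1) := by
  have h1 : Measurable fun q : Joint n m × (Fin N × ((ℕ → Ξx) × (ℕ → Ξy))) => (q.1, q.2.2.1) :=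
    measurable_fst.prodMk (measurable_fst.comp (measurable_snd.comp measurable_snd))
  have h2 : Measurable fun q : Joint n m × (Fin N × ((ℕ → Ξx) × (ℕ → Ξy))) => (q.1, q.2.2.2) :=
    measurable_fst.prodMk (measurable_snd.comp (measurable_snd.comp measurable_snd))
  exact measurable_fst.prodMk
    (((measurable_batchX hOx Mx).comp h1).prodMk ((measurable_batchY hOy My).comp h2))

theorem measurable_drawStep {η τ : ℝ} (hg : ∀ i, Measurable (prox τ (D.g i)))
    (hh : Measurable (prox η D.h)) (hOx : Measurable fun q : Joint n m × Ξx => O.gradX q.1 q.2)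
    (hOy : Measurable fun q : Joint n m × Ξy => O.gradY q.1 q.2) (Mx My : ℕ) :
    Measurable fun q : Joint n m × (Fin N × ((ℕ → Ξx) × (ℕ → Ξy))) =>
      drawStep D O η τ Mx My q.1 q.2 := by
  have h1 : Measurable fun q : Fin N × (Joint n m × Primal n × Dual m) =>
      D.blockStep η τ q.2.1 q.1 q.2.2.1 q.2.2.2 :=
    measurable_from_prod_countable_right fun i => measurable_blockStep hg hh i
  have h2 : Measurable fun q : Joint n m × (Fin N × ((ℕ → Ξx) × (ℕ → Ξy))) => q.2.1 :=
    measurable_fst.comp measurable_snd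
  exact h1.comp (h2.prodMk (measurable_batches hOx hOy Mx My))

theorem measurable_drawGradMap {η τ : ℝ} (hg : ∀ i, Measurable (prox τ (D.g i)))
    (hh : Measurable (prox η D.h)) (hOx : Measurable fun q : Joint n m × Ξx => O.gradX q.1 q.2)
    (hOy : Measurable fun q : Joint n m × Ξy => O.gradY q.1 q.2) (Mx My : ℕ) :
    Measurable fun q : Joint n m × (Fin N × ((ℕ → Ξx) × (ℕ → Ξy))) =>
      drawGradMap D O η τ Mx My q.1 q.2 := by
  have h := (measurable_proxGradMap hg hh).comp
    (measurable_batches (N := N) (O := O) hOx hOy Mx My)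
  simp only [Function.comp_def] at h
  exact h

end Measurability

section Batches

variable [MeasurableSpace Ξx] [MeasurableSpace Ξy] [MeasurableSpace Ω] {P : Measure Ω}
  [IsProbabilityMeasure P] {Px : Measure Ξx}
  {Py : Measure Ξy} {D : Problem n m} {O : Oracle n m Ξx Ξy} {σx σy : ℝ}

/-- Mini-batches give unbiased estimates with reduced variance. -/
theorem Oracle.Valid.unbiasedAt (hO : O.Valid D Px Py σx σy) {z : Joint n m}
    (hz : z ∈ D.feasible) {ω : ℕ → Ω → Ξx} {ζ : ℕ → Ω → Ξy} (hω : ∀ j, Measurable (ω j))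
    (hζ : ∀ j, Measurable (ζ j)) (hωl : ∀ j, P.map (ω j) = Px) (hζl : ∀ j, P.map (ζ j) = Py)
    (hωi : iIndepFun ω P) (hζi : iIndepFun ζ P) {Mx My : ℕ} (hMx : 0 < Mx) (hMy : 0 < My) :
    D.UnbiasedAt P z (fun a => batchX O Mx (fun j => ω j a) z)
      (fun a => batchY O My (fun j => ζ j a) z) (σx ^ 2 / N / Mx) (σy ^ 2 / My) := by
  have hgx : Measurable fun w => O.gradX z w := hO.measurable_x.comp measurable_prodMk_left
  have hgy : Measurable fun w => O.gradY z w := hO.measurable_y.comp measurable_prodMk_left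
  have hgxi : ∀ i, Measurable fun w => O.gradX z w i := fun i => by fun_prop
  have hx : ∀ i, _ := fun i => batch_mean (P := P) (X := fun j a => O.gradX z (ω j a) i)
    (g := (∇ D.f z).fst i) (v := σx ^ 2 / N) hMx
    (hωi.comp (fun _ w => O.gradX z w i) fun _ => hgxi i)
    (fun j => by
      have h := hO.integrable_x z hz i
      rw [← hωl j] at h
      exact h.comp_measurable (hω j))
    (fun j => by
      rw [← hO.mean_x z hz i, ← hωl j,
        integral_map (hω j).aemeasurable (hgxi i).aestronglyMeasurable])
    (fun j => by
      have h := hO.integrable_sq_x z hz i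
      rw [← hωl j] at h
      exact h.comp_measurable (hω j))
    (fun j => by
      have h := hO.var_x z hz i
      rw [← hωl j, integral_map (hω j).aemeasurable (by
        exact (((hgxi i).sub_const _).norm.pow_const 2).aestronglyMeasurable)] at h
      exact h)
  have hy := batch_mean (P := P) (X := fun j a => O.gradY z (ζ j a))
    (g := (∇ D.f z).snd) (v := σy ^ 2) hMy
    (hζi.comp (fun _ w => O.gradY z w) fun _ => hgy)
    (fun j => by
      have h := hO.integrable_y z hz
      rw [← hζl j] at h
      exact h.comp_measurable (hζ j))
    (fun j => by
      rw [← hO.mean_y z hz, ← hζl j,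
        integral_map (hζ j).aemeasurable hgy.aestronglyMeasurable])
    (fun j => by
      have h := hO.integrable_sq_y z hz
      rw [← hζl j] at h
      exact h.comp_measurable (hζ j))
    (fun j => by
      have h := hO.var_y z hz
      rw [← hζl j, integral_map (hζ j).aemeasurable (by
        exact ((hgy.sub_const _).norm.pow_const 2).aestronglyMeasurable)] at h
      exact h)
  refine ⟨fun i => ?_, hy.1, fun i => ?_, hy.2.1, fun i => ?_, hy.2.2.1, fun i => ?_, hy.2.2.2⟩
  all_goals simp_rw [batchX_apply]
  · exact (hx i).1
  · exact (hx i).2.1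
  · exact (hx i).2.2.1
  · exact (hx i).2.2.2

end Batches

section Independence

variable [MeasurableSpace Ξx] [MeasurableSpace Ξy] {T : ℕ} {R : Sampling N T Ξx Ξy Ω}

/-- All draws of iteration `k` in the `t`-th run of round `ℓ`. -/
def Sampling.draw (R : Sampling N T Ξx Ξy Ω) (ℓ : ℕ) (t : Fin T) (k : ℕ) (a : Ω) :
    Fin N × ((ℕ → Ξx) × (ℕ → Ξy)) :=
  (R.block ℓ t k a, (fun j => R.omega ℓ t k j a, fun j => R.zeta ℓ t k j a))

theorem Sampling.measurable_draw {m' : MeasurableSpace Ω} {ℓ : ℕ} {t : Fin T} {k : ℕ}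
    (h1 : R.sigma (.block ℓ t k) ≤ m') (h2 : R.sigma (.noise ℓ t k) ≤ m') :
    Measurable[m'] (R.draw ℓ t k) :=
  Measurable.prodMk ((comap_measurable (R.block ℓ t k)).mono h1 le_rfl)
    ((comap_measurable (fun a => ((fun j => R.omega ℓ t k j a, fun j => R.zeta ℓ t k j a) :
        (ℕ → Ξx) × (ℕ → Ξy)))).mono h2 le_rfl)

/-- The run of a draw. -/
def Draw.label : Draw T → ℕ × Fin T
  | .block ℓ t _ => (ℓ, t)
  | .noise ℓ t _ => (ℓ, t)
  | .pick ℓ t => (ℓ, t)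

variable [mΩ : MeasurableSpace Ω] {P : Measure Ω} {Px : Measure Ξx} {Py : Measure Ξy} {K : ℕ → ℕ}

theorem Sampling.Valid.sigma_le (hR : R.Valid P Px Py K) (d : Draw T) : R.sigma d ≤ mΩ := by
  cases d with
  | block ℓ t k => exact (hR.measurable_block ℓ t k).comap_le
  | noise ℓ t k =>
    exact (Measurable.prodMk (measurable_pi_iff.2 fun j => hR.measurable_omega ℓ t k j)
      (measurable_pi_iff.2 fun j => hR.measurable_zeta ℓ t k j)).comap_le
  | pick ℓ t => exact (hR.measurable_pick ℓ t).comap_le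

/-- Random variables that depend on disjoint sets of draws are independent. -/
theorem Sampling.Valid.indepFun (hR : R.Valid P Px Py K) {S S' : Set (Draw T)}
    (hS : Disjoint S S') {β β' : Type*} [MeasurableSpace β] [MeasurableSpace β'] {X : Ω → β}
    {Y : Ω → β'} (hX : Measurable[⨆ d ∈ S, R.sigma d] X)
    (hY : Measurable[⨆ d ∈ S', R.sigma d] Y) : IndepFun X Y P :=
  indep_of_indep_of_le_left (indep_of_indep_of_le_right
    (indep_iSup_of_disjoint hR.sigma_le hR.indep hS) hY.comap_le) hX.comap_le

end Independence

end Draws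

/-! ### Failure probabilities of runs and rounds. -/

section Run

variable {N : ℕ} {n : Fin N → ℕ} {m : ℕ} {Ξx Ξy Ω : Type*}
  {D : Problem n m} {O : Oracle n m Ξx Ξy} {A : Input n m} {L : ℝ≥0}
  {R : Sampling N A.numRuns Ξx Ξy Ω}

/-- The iterates of the `t`-th run of round `ℓ`. -/
def runIterate (A : Input n m) (D : Problem n m) (O : Oracle n m Ξx Ξy)
    (R : Sampling N A.numRuns Ξx Ξy Ω) (ℓ : ℕ) (t : Fin A.numRuns) (k : ℕ) (a : Ω) : Joint n m :=
  rbsgda D O (A.etaX ℓ) (A.etaY ℓ) A.batchSizeX (A.batchSizeY ℓ)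
    (fun k => R.block ℓ t k a) (fun k j => R.omega ℓ t k j a) (fun k j => R.zeta ℓ t k j a)
    (pair A.x0 A.y0) k

/-- The squared norm of the stochastic gradient map in iteration `k`. -/
def iterValue (A : Input n m) (D : Problem n m) (O : Oracle n m Ξx Ξy)
    (R : Sampling N A.numRuns Ξx Ξy Ω) (ℓ : ℕ) (t : Fin A.numRuns) (k : ℕ) (a : Ω) : ℝ :=
  ‖drawGradMap D O (A.etaY ℓ) (A.etaX ℓ) A.batchSizeX (A.batchSizeY ℓ)
    (runIterate A D O R ℓ t k a) (R.draw ℓ t k a)‖ ^ 2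

theorem runValue_eq (ℓ : ℕ) (t : Fin A.numRuns) (a : Ω) :
    runValue A D O R ℓ t a = iterValue A D O R ℓ t (R.pick ℓ t a) a := rfl

theorem runIterate_succ (ℓ : ℕ) (t : Fin A.numRuns) (k : ℕ) (a : Ω) :
    runIterate A D O R ℓ t (k + 1) a
      = drawStep D O (A.etaY ℓ) (A.etaX ℓ) A.batchSizeX (A.batchSizeY ℓ)
        (runIterate A D O R ℓ t k a) (R.draw ℓ t k a) := rfl

theorem stopCond_of_le {ℓ : ℕ} {t : Fin A.numRuns} {a : Ω}
    (h : runValue A D O R ℓ t a ≤ A.ε ^ 2 / 4) : stopCond A D O R ℓ a := by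
  have : Nonempty (Fin A.numRuns) := ⟨t⟩
  obtain ⟨s, hs⟩ := Finite.exists_min fun s => runValue A D O R ℓ s a
  exact ⟨s, hs, (hs t).trans h⟩

theorem stopRound_le {ℓ : ℕ} (hℓ : 1 ≤ ℓ) {a : Ω} (h : stopCond A D O R ℓ a) :
    stopRound A D O R a ≤ ℓ := by
  rw [stopRound]
  exact iInf₂_le ℓ ⟨hℓ, h⟩

theorem measurable_prox_g (hD : D.Regular L A.μ A.Fbar) (hA : A.Valid D) (hN : 1 ≤ N) (ℓ : ℕ)
    (i : Fin N) : Measurable (prox (A.etaX ℓ) (D.g i)) :=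
  (continuous_prox (hD.closedConvex_g i) ⟨_, hD.mem_effDom_gSum.1 hA.x0_mem i⟩
    (hA.etaX_pos hN ℓ)).measurable

theorem measurable_prox_h (hD : D.Regular L A.μ A.Fbar) (hA : A.Valid D) (ℓ : ℕ) :
    Measurable (prox (A.etaY ℓ) D.h) :=
  (continuous_prox hD.closedConvex_h ⟨_, hA.y0_mem⟩ (hA.etaY_pos ℓ)).measurable

variable [MeasurableSpace Ξx] [MeasurableSpace Ξy] {Px : Measure Ξx} {Py : Measure Ξy}

/-- The σ-algebra `m'` is arbitrary: the ambient one gives ordinary measurability, while the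
supremum of `sigma` over a set of draws expresses dependence on those draws only, as independence
arguments require. -/
theorem measurable_runIterate (hD : D.Regular L A.μ A.Fbar) (hA : A.Valid D) (hN : 1 ≤ N)
    (hO : O.Valid D Px Py A.σx A.σy) {m' : MeasurableSpace Ω} {ℓ : ℕ} {t : Fin A.numRuns} {k : ℕ}
    (h : ∀ j < k, R.sigma (.block ℓ t j) ≤ m' ∧ R.sigma (.noise ℓ t j) ≤ m') :
    Measurable[m'] (runIterate A D O R ℓ t k) :=
  measurable_recursion (measurable_drawStep (measurable_prox_g hD hA hN ℓ)
    (measurable_prox_h hD hA ℓ) hO.measurable_x hO.measurable_y _ _) (fun _ => rfl)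
    (fun k a => runIterate_succ ℓ t k a) k fun j hj => R.measurable_draw (h j hj).1 (h j hj).2

theorem measurable_iterValue (hD : D.Regular L A.μ A.Fbar) (hA : A.Valid D) (hN : 1 ≤ N)
    (hO : O.Valid D Px Py A.σx A.σy) {m' : MeasurableSpace Ω} {ℓ : ℕ} {t : Fin A.numRuns} {k : ℕ}
    (h : ∀ j ≤ k, R.sigma (.block ℓ t j) ≤ m' ∧ R.sigma (.noise ℓ t j) ≤ m') :
    Measurable[m'] (iterValue A D O R ℓ t k) := by
  have h1 := measurable_runIterate (m' := m') (R := R) (t := t) (k := k) hD hA hN hO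
    fun j hj => h j hj.le
  have h2 : Measurable[m'] (R.draw ℓ t k) := R.measurable_draw (h k le_rfl).1 (h k le_rfl).2
  have h3 := (measurable_drawGradMap (measurable_prox_g hD hA hN ℓ)
    (measurable_prox_h hD hA ℓ) hO.measurable_x hO.measurable_y A.batchSizeX
    (A.batchSizeY ℓ)).comp (h1.prodMk h2)
  exact h3.norm.pow_const 2

theorem measurable_runValue (hD : D.Regular L A.μ A.Fbar) (hA : A.Valid D) (hN : 1 ≤ N)
    (hO : O.Valid D Px Py A.σx A.σy) {m' : MeasurableSpace Ω} {ℓ : ℕ} {t : Fin A.numRuns}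
    (h : ∀ d : Draw A.numRuns, d.label = (ℓ, t) → R.sigma d ≤ m') :
    Measurable[m'] (runValue A D O R ℓ t) := by
  -- The returned index is random but takes countably many values, so joint measurability reduces to
  -- fixed `k`.
  have h1 : Measurable fun q : ℕ × Ω => iterValue A D O R ℓ t q.1 q.2 :=
    measurable_from_prod_countable_right fun k => measurable_iterValue hD hA hN hO fun j _ =>
      ⟨h (.block ℓ t j) rfl, h (.noise ℓ t j) rfl⟩
  have h2 : Measurable[m'] (R.pick ℓ t) := (comap_measurable _).mono (h (.pick ℓ t) rfl) le_rfl
  have h3 := h1.comp (h2.prodMk measurable_id)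
  rw [show runValue A D O R ℓ t = fun a => iterValue A D O R ℓ t (R.pick ℓ t a) a from
    funext (runValue_eq ℓ t)]
  exact h3

variable [mΩ : MeasurableSpace Ω] {P : Measure Ω}

/-- The iterate at time `k` is a function of the draws at times `j < k` only. -/
theorem indepFun_runIterate (hD : D.Regular L A.μ A.Fbar) (hA : A.Valid D) (hN : 1 ≤ N)
    (hO : O.Valid D Px Py A.σx A.σy) (hR : R.Valid P Px Py (A.numIter D)) (ℓ : ℕ)
    (t : Fin A.numRuns) (k : ℕ) : IndepFun (runIterate A D O R ℓ t k) (R.draw ℓ t k) P := by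
  let S : Set (Draw A.numRuns) := {d | ∃ j < k, d = .block ℓ t j ∨ d = .noise ℓ t j}
  let S' : Set (Draw A.numRuns) := {.block ℓ t k, .noise ℓ t k}
  refine hR.indepFun (S := S) (S' := S') ?_ ?_ ?_
  · rw [Set.disjoint_left]
    rintro d ⟨j, hj, hd⟩ hd'
    have hd2 : d = .block ℓ t k ∨ d = .noise ℓ t k := hd'
    rcases hd with rfl | rfl <;> rcases hd2 with h | h <;> cases h <;> exact lt_irrefl _ hj
  · exact measurable_runIterate hD hA hN hO fun j hj =>
      ⟨le_iSup₂_of_le _ ⟨j, hj, Or.inl rfl⟩ le_rfl, le_iSup₂_of_le _ ⟨j, hj, Or.inr rfl⟩ le_rfl⟩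
  · exact R.measurable_draw (le_iSup₂_of_le _ (Or.inl rfl) le_rfl)
      (le_iSup₂_of_le _ (Or.inr rfl) le_rfl)

theorem indepFun_block_batches (hO : O.Valid D Px Py A.σx A.σy)
    (hR : R.Valid P Px Py (A.numIter D)) (ℓ : ℕ) (t : Fin A.numRuns) (k Mx My : ℕ)
    (z : Joint n m) :
    IndepFun (R.block ℓ t k) (fun a => (batchX O Mx (fun j => R.omega ℓ t k j a) z,
      batchY O My (fun j => R.zeta ℓ t k j a) z)) P := by
  have h : IndepFun (R.block ℓ t k)
      (fun a => ((fun j => R.omega ℓ t k j a, fun j => R.zeta ℓ t k j a) :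
        (ℕ → Ξx) × (ℕ → Ξy))) P := by
    refine hR.indepFun (S := {.block ℓ t k}) (S' := {.noise ℓ t k}) (by simp) ?_ ?_
    · exact (comap_measurable _).mono (le_iSup₂_of_le (.block ℓ t k) rfl le_rfl) le_rfl
    · exact (comap_measurable _).mono (le_iSup₂_of_le (.noise ℓ t k) rfl le_rfl) le_rfl
  have hx := (measurable_batchX hO.measurable_x Mx).comp (measurable_prodMk_left (x := z))
  have hy := (measurable_batchY hO.measurable_y My).comp (measurable_prodMk_left (x := z))
  simp only [Function.comp_def] at hx hy
  exact h.comp measurable_id ((hx.comp measurable_fst).prodMk (hy.comp measurable_snd))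

variable [IsProbabilityMeasure P]

/-- The convergence of RB-SGDA in expectation. -/
theorem sum_lintegral_iterValue_le (hD : D.Regular L A.μ A.Fbar) (hA : A.Valid D) (hN : 1 ≤ N)
    (hO : O.Valid D Px Py A.σx A.σy) (hR : R.Valid P Px Py (A.numIter D)) {ℓ : ℕ} (hℓ : 1 ≤ ℓ)
    (hL : L * A.etaY ℓ ≤ 1) (t : Fin A.numRuns) :
    ∑ k ∈ Finset.range (A.numIter D ℓ),
        ∫⁻ a, ENNReal.ofReal (A.etaX ℓ / (4 * N) * iterValue A D O R ℓ t k a) ∂P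
      ≤ ENNReal.ofReal (A.numIter D ℓ * (A.etaX ℓ / (4 * N) * (A.ε ^ 2 / 8))) := by
  have hS := hA.admissibleSteps hN hℓ hL
  have hτ := hS.τ_pos
  have hη := hS.η_pos
  have hN' : (0 : ℝ) < N := by exact_mod_cast hN
  have hMx := Input.Valid.batchSizeX_pos A
  obtain ⟨hMy, hny⟩ := hA.noiseY_le hS.μη_lt_one
  have hnx := hA.noiseX_le
  have hz₀ : pair A.x0 A.y0 ∈ D.feasible := ⟨hA.x0_mem, hA.y0_mem⟩
  set b : ℝ := A.etaX ℓ * (A.σx ^ 2 / N / A.batchSizeX) + A.etaY ℓ ^ 2 * A.rho * A.μ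
    * (A.μ * A.etaY ℓ + 6 * ((2 - A.μ * A.etaY ℓ) / (1 - A.μ * A.etaY ℓ)))
    * (A.σy ^ 2 / A.batchSizeY ℓ) with hb
  -- Two noise terms of at most `η_x/N · ε²/128` each make up the second half of the budget `ε²/8`.
  have hb1 : b ≤ A.etaX ℓ / (4 * N) * (A.ε ^ 2 / 16) := by
    have h1 : A.etaX ℓ * (A.σx ^ 2 / N / A.batchSizeX)
        = A.etaX ℓ / N * (A.σx ^ 2 / A.batchSizeX) := by
      field_simp
    have h2 : A.etaY ℓ ^ 2 * A.rho * A.μ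
        * (A.μ * A.etaY ℓ + 6 * ((2 - A.μ * A.etaY ℓ) / (1 - A.μ * A.etaY ℓ)))
        = A.etaX ℓ / N * (1 + 6 / (A.μ * A.etaY ℓ)
          * ((2 - A.μ * A.etaY ℓ) / (1 - A.μ * A.etaY ℓ))) := by
      have hμ := hS.μ_pos
      rw [hS.τ_eq]
      generalize (2 - A.μ * A.etaY ℓ) / (1 - A.μ * A.etaY ℓ) = q
      field_simp
    rw [hb, h1, h2, mul_assoc]
    have h3 := mul_le_mul_of_nonneg_left hnx (show 0 ≤ A.etaX ℓ / N by positivity)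
    have h4 := mul_le_mul_of_nonneg_left hny (show 0 ≤ A.etaX ℓ / N by positivity)
    have h5 : A.etaX ℓ / (4 * N) * (A.ε ^ 2 / 16)
        = A.etaX ℓ / N * (A.ε ^ 2 / 128) + A.etaX ℓ / N * (A.ε ^ 2 / 128) := by
      field_simp
      ring
    linarith
  have h := sum_lintegral_cost_le (P := P)
    (step := drawStep D O (A.etaY ℓ) (A.etaX ℓ) A.batchSizeX (A.batchSizeY ℓ))
    (cost := fun z ξ => ENNReal.ofReal (A.etaX ℓ / (4 * N) *
      ‖drawGradMap D O (A.etaY ℓ) (A.etaX ℓ) A.batchSizeX (A.batchSizeY ℓ) z ξ‖ ^ 2))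
    (ξ := R.draw ℓ t) (Z := runIterate A D O R ℓ t) (z₀ := pair A.x0 A.y0)
    (measurable_drawStep (measurable_prox_g hD hA hN ℓ)
      (measurable_prox_h hD hA ℓ) hO.measurable_x hO.measurable_y _ _)
    ((((measurable_drawGradMap (measurable_prox_g hD hA hN ℓ)
      (measurable_prox_h hD hA ℓ) hO.measurable_x hO.measurable_y _ _).norm.pow_const
        2).const_mul _).ennreal_ofReal)
    (fun k => R.measurable_draw (hR.sigma_le _) (hR.sigma_le _)) (fun _ => rfl)
    (fun k a => runIterate_succ ℓ t k a) (indepFun_runIterate hD hA hN hO hR ℓ t)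
    (C := D.feasible) hz₀ (fun z hz ξ => hD.blockStep_mem hτ hη hz _ _ _)
    (V := fun z => ENNReal.ofReal (D.lyapunov A.μ A.rho z - A.Fbar)) (b := ENNReal.ofReal b)
    (fun k z hz => hD.lintegral_lyapunov_step hS hz (hR.measurable_block ℓ t k)
      (hR.law_block ℓ t k)
      (((measurable_batchX hO.measurable_x A.batchSizeX).comp measurable_prodMk_left).comp
        (measurable_pi_iff.2 fun j => hR.measurable_omega ℓ t k j))
      (indepFun_block_batches hO hR ℓ t k A.batchSizeX (A.batchSizeY ℓ) z)
      (hO.unbiasedAt hz (hR.measurable_omega ℓ t k) (hR.measurable_zeta ℓ t k)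
        (hR.law_omega ℓ t k) (hR.law_zeta ℓ t k) (hR.indep_omega ℓ t k) (hR.indep_zeta ℓ t k)
        hMx hMy)) (A.numIter D ℓ)
  clear_value b
  refine h.trans ?_
  have hgap := hA.gap_le (D := D) hN ℓ
  have hlyap := hA.lyapunov_le hN hD
  have hB : 0 ≤ A.etaX ℓ / (4 * N) * (A.ε ^ 2 / 16) := by positivity
  set B := A.etaX ℓ / (4 * N) * (A.ε ^ 2 / 16) with hBdef
  have h8 : A.numIter D ℓ * (A.etaX ℓ / (4 * N) * (A.ε ^ 2 / 8))
      = A.numIter D ℓ * B + A.numIter D ℓ * B := by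
    rw [hBdef]; ring
  clear_value B
  rw [h8, ENNReal.ofReal_add (by positivity) (by positivity)]
  refine add_le_add (ENNReal.ofReal_le_ofReal (by linarith)) ?_
  rw [ENNReal.ofReal_mul (Nat.cast_nonneg _), ENNReal.ofReal_natCast]
  exact mul_le_mul_right (ENNReal.ofReal_le_ofReal hb1) _

/-- A run of RB-SGDA in a round with a small step size fails with probability at most `1/2`. -/
theorem measure_fail_le_half (hD : D.Regular L A.μ A.Fbar) (hA : A.Valid D) (hN : 1 ≤ N)
    (hO : O.Valid D Px Py A.σx A.σy) (hR : R.Valid P Px Py (A.numIter D)) {ℓ : ℕ} (hℓ : 1 ≤ ℓ)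
    (hL : L * A.etaY ℓ ≤ 1) (t : Fin A.numRuns) :
    P {a | A.ε ^ 2 / 4 < runValue A D O R ℓ t a} ≤ 1 / 2 := by
  have hsum := sum_lintegral_iterValue_le hD hA hN hO hR hℓ hL t
  have hK := hA.numIter_pos hN hD ℓ
  have hτ := hA.etaX_pos hN ℓ
  have hε := hA.ε_pos
  have hN' : (0 : ℝ) < N := by exact_mod_cast hN
  set K := A.numIter D ℓ with hKdef
  have hKr : (0 : ℝ) < K := by exact_mod_cast hK
  set c := A.etaX ℓ / (4 * N) with hc
  have hc0 : 0 < c := by positivity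
  have hm : ∀ k, Measurable (iterValue A D O R ℓ t k) := fun k =>
    measurable_iterValue hD hA hN hO fun j _ => ⟨hR.sigma_le _, hR.sigma_le _⟩
  let E : ℕ → Set Ω := fun k => {a | A.ε ^ 2 / 4 < iterValue A D O R ℓ t k a}
  -- Markov's inequality at every fixed iteration; summed, the ratio of `ε²/8` to `ε²/4` gives
  -- `K/2`.
  have hmarkov : ∀ k, ENNReal.ofReal (c * (A.ε ^ 2 / 4)) * P (E k)
      ≤ ∫⁻ a, ENNReal.ofReal (c * iterValue A D O R ℓ t k a) ∂P := by
    intro k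
    refine le_trans ?_ (mul_meas_ge_le_lintegral (((hm k).const_mul c).ennreal_ofReal)
      (ENNReal.ofReal (c * (A.ε ^ 2 / 4))))
    refine mul_le_mul_right (measure_mono fun a ha => ?_) _
    exact ENNReal.ofReal_le_ofReal (mul_le_mul_of_nonneg_left (le_of_lt ha) hc0.le)
  have hsumP : ∑ k ∈ Finset.range K, P (E k) ≤ (K : ℝ≥0∞) / 2 := by
    have h1 : ENNReal.ofReal (c * (A.ε ^ 2 / 4)) * ∑ k ∈ Finset.range K, P (E k)
        ≤ ENNReal.ofReal (c * (A.ε ^ 2 / 4)) * ((K : ℝ≥0∞) / 2) := by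
      rw [Finset.mul_sum]
      refine (Finset.sum_le_sum fun k _ => hmarkov k).trans (hsum.trans_eq ?_)
      rw [show (K : ℝ≥0∞) / 2 = ENNReal.ofReal (K / 2) by
        rw [ENNReal.ofReal_div_of_pos two_pos, ENNReal.ofReal_natCast, ENNReal.ofReal_ofNat],
        ← ENNReal.ofReal_mul (by positivity)]
      congr 1
      ring
    exact (ENNReal.mul_le_mul_iff_right (by simp; positivity) ENNReal.ofReal_ne_top).1 h1
  -- The returned index is a separate draw, independent of all iterates and batches of its run.
  have hpick : ∀ k < K, P (R.pick ℓ t ⁻¹' {k} ∩ E k) = (K : ℝ≥0∞)⁻¹ * P (E k) := by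
    intro k hk
    let S : Set (Draw A.numRuns) := {d | ∃ j, d = .block ℓ t j ∨ d = .noise ℓ t j}
    have hind : IndepFun (R.pick ℓ t) (iterValue A D O R ℓ t k) P := by
      refine hR.indepFun (S := {.pick ℓ t}) (S' := S) ?_ ?_ ?_
      · rw [Set.disjoint_left]
        rintro d hd ⟨j, hj⟩
        have hd' : d = .pick ℓ t := hd
        subst hd'
        rcases hj with h | h <;> cases h
      · exact (comap_measurable _).mono (le_iSup₂_of_le (.pick ℓ t) rfl le_rfl) le_rfl
      · exact measurable_iterValue hD hA hN hO fun j _ =>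
          ⟨le_iSup₂_of_le _ ⟨j, Or.inl rfl⟩ le_rfl, le_iSup₂_of_le _ ⟨j, Or.inr rfl⟩ le_rfl⟩
    have h1 := hind.measure_inter_preimage_eq_mul {k} (Set.Ioi (A.ε ^ 2 / 4))
      (measurableSet_singleton k) measurableSet_Ioi
    have h2 : P (R.pick ℓ t ⁻¹' {k}) = (K : ℝ≥0∞)⁻¹ := by
      rw [← Measure.map_apply (hR.measurable_pick ℓ t) (measurableSet_singleton k), hR.law_pick,
        uniformOn, cond_apply measurableSet_Iio, Set.inter_eq_right.2 (by simpa using hk),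
        Measure.count_singleton, mul_one, ← hKdef,
        Measure.count_apply_finite _ (Set.finite_Iio K)]
      simp
    rw [← h2]
    exact h1
  have hout : P {a | ¬ R.pick ℓ t a < K} = 0 := by
    have h1 : {a | ¬ R.pick ℓ t a < K} = R.pick ℓ t ⁻¹' (Set.Iio K)ᶜ := by ext; simp
    rw [h1, ← Measure.map_apply (hR.measurable_pick ℓ t) measurableSet_Iio.compl, hR.law_pick,
      uniformOn, cond_apply measurableSet_Iio, ← hKdef, Set.inter_compl_self, measure_empty,
      mul_zero]
  calc P {a | A.ε ^ 2 / 4 < runValue A D O R ℓ t a}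
      ≤ P ({a | ¬ R.pick ℓ t a < K}
          ∪ ⋃ k ∈ Finset.range K, (R.pick ℓ t ⁻¹' {k} ∩ E k)) := by
        refine measure_mono fun a ha => ?_
        by_cases hp : R.pick ℓ t a < K
        · rw [Set.mem_ofPred_eq, runValue_eq] at ha
          exact Or.inr (Set.mem_iUnion₂.2 ⟨R.pick ℓ t a, Finset.mem_range.2 hp, rfl, ha⟩)
        · exact Or.inl hp
    _ ≤ 0 + ∑ k ∈ Finset.range K, (K : ℝ≥0∞)⁻¹ * P (E k) := by
        refine (measure_union_le _ _).trans (add_le_add hout.le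
          ((measure_biUnion_finset_le _ _).trans (Finset.sum_le_sum fun k hk => ?_)))
        exact (hpick k (Finset.mem_range.1 hk)).le
    _ ≤ (K : ℝ≥0∞)⁻¹ * ((K : ℝ≥0∞) / 2) := by
        rw [zero_add, ← Finset.mul_sum]
        exact mul_le_mul_right hsumP _
    _ = 1 / 2 := by
        rw [ENNReal.div_eq_inv_mul, mul_left_comm, ENNReal.inv_mul_cancel (by simpa using hK.ne')
          (ENNReal.natCast_ne_top _), mul_one, one_div]

/-- Runs fail independently: finitely many runs in rounds with small step sizes all fail with
probability at most `2⁻ʲ`, where `j` is their number. -/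
theorem measureReal_all_fail_le (hD : D.Regular L A.μ A.Fbar) (hA : A.Valid D) (hN : 1 ≤ N)
    (hO : O.Valid D Px Py A.σx A.σy) (hR : R.Valid P Px Py (A.numIter D))
    (F : Finset (ℕ × Fin A.numRuns)) (hF : ∀ s ∈ F, 1 ≤ s.1 ∧ L * A.etaY s.1 ≤ 1) :
    P.real (⋂ s ∈ F, {a | A.ε ^ 2 / 4 < runValue A D O R s.1 s.2 a}) ≤ (1 / 2) ^ F.card := by
  have h := measure_biInter_of_label (P := P) hR.sigma_le hR.indep Draw.label
    (E := fun s => {a | A.ε ^ 2 / 4 < runValue A D O R s.1 s.2 a})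
    (fun s => by
      have h1 : Measurable[⨆ d ∈ Draw.label ⁻¹' {s}, R.sigma d] (runValue A D O R s.1 s.2) :=
        measurable_runValue hD hA hN hO fun d hd => le_iSup₂_of_le d hd le_rfl
      exact h1 measurableSet_Ioi) F
  have h2 : P (⋂ s ∈ F, {a | A.ε ^ 2 / 4 < runValue A D O R s.1 s.2 a})
      ≤ (1 / 2) ^ F.card := by
    rw [h, ← Finset.prod_const]
    exact Finset.prod_le_prod' fun s hs =>
      measure_fail_le_half hD hA hN hO hR (hF s hs).1 (hF s hs).2 s.2
  have h3 := ENNReal.toReal_mono (by finiteness) h2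
  simpa [Measure.real] using h3

/-- In a round with a small step size SGDA-B stops with probability at least `1 - p`. -/
theorem le_measureReal_stopCond (hD : D.Regular L A.μ A.Fbar) (hA : A.Valid D) (hN : 1 ≤ N)
    (hO : O.Valid D Px Py A.σx A.σy) (hR : R.Valid P Px Py (A.numIter D)) {ℓ : ℕ} (hℓ : 1 ≤ ℓ)
    (hL : L * A.etaY ℓ ≤ 1) : 1 - A.p ≤ P.real {a | stopCond A D O R ℓ a} := by
  classical
  let F : Finset (ℕ × Fin A.numRuns) := Finset.univ.map ⟨fun t => (ℓ, t), Prod.mk_right_injective ℓ⟩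
  have hcard : F.card = A.numRuns := by simp [F]
  have h1 := measureReal_all_fail_le (P := P) (R := R) hD hA hN hO hR F (by
    intro s hs
    obtain ⟨t, -, rfl⟩ := Finset.mem_map.1 hs
    exact ⟨hℓ, hL⟩)
  rw [hcard] at h1
  have h2 := h1.trans hA.half_pow_numRuns_le
  -- Only the event that all runs fail has to be measurable; the stopping event contains its
  -- complement, and monotonicity suffices.
  have hmeas : MeasurableSet (⋂ s ∈ F, {a | A.ε ^ 2 / 4 < runValue A D O R s.1 s.2 a}) :=
    Finset.measurableSet_biInter F fun s _ =>
      (measurable_runValue hD hA hN hO fun d _ => hR.sigma_le d) measurableSet_Ioi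
  have h3 := probReal_compl_eq_one_sub (μ := P) hmeas
  refine le_trans (by linarith) (measureReal_mono (μ := P)
    (s₁ := (⋂ s ∈ F, {a | A.ε ^ 2 / 4 < runValue A D O R s.1 s.2 a})ᶜ) fun a ha => ?_)
  by_contra hcon
  refine ha (Set.mem_iInter₂.2 fun s hs => ?_)
  obtain ⟨t, -, rfl⟩ := Finset.mem_map.1 hs
  by_contra hlt
  exact hcon (stopCond_of_le (not_lt.1 hlt))

/-- SGDA-B stops almost surely if the step sizes are small from some round on. -/
theorem ae_stopRound_lt_top (hD : D.Regular L A.μ A.Fbar) (hA : A.Valid D) (hN : 1 ≤ N)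
    (hO : O.Valid D Px Py A.σx A.σy) (hR : R.Valid P Px Py (A.numIter D)) {ℓ₀ : ℕ}
    (hℓ₀ : 1 ≤ ℓ₀) (hL : ∀ ℓ, ℓ₀ ≤ ℓ → L * A.etaY ℓ ≤ 1) :
    ∀ᵐ a ∂P, stopRound A D O R a < ⊤ := by
  classical
  let t₀ : Fin A.numRuns := ⟨0, hA.numRuns_pos⟩
  have hle : ∀ J : ℕ, P.real {a | ¬ stopRound A D O R a < ⊤} ≤ (1 / 2) ^ J := by
    intro J
    -- One run from each of `J` consecutive rounds is enough: never stopping forces all of them to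
    -- fail.
    let F : Finset (ℕ × Fin A.numRuns) :=
      (Finset.range J).map ⟨fun j => (ℓ₀ + j, t₀), fun i j hij => by simpa using hij⟩
    have hcard : F.card = J := by simp [F]
    have h1 := measureReal_all_fail_le (P := P) (R := R) hD hA hN hO hR F (by
      intro s hs
      obtain ⟨j, -, rfl⟩ := Finset.mem_map.1 hs
      exact ⟨hℓ₀.trans (Nat.le_add_right _ _), hL _ (Nat.le_add_right _ _)⟩)
    rw [hcard] at h1
    refine le_trans (measureReal_mono fun a ha => ?_) h1
    refine Set.mem_iInter₂.2 fun s hs => ?_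
    obtain ⟨j, -, rfl⟩ := Finset.mem_map.1 hs
    by_contra hlt
    exact ha (lt_of_le_of_lt (stopRound_le (hℓ₀.trans (Nat.le_add_right _ _))
      (stopCond_of_le (not_lt.1 hlt))) (ENat.natCast_lt_top _))
  have h0 : P.real {a | ¬ stopRound A D O R a < ⊤} ≤ 0 :=
    ge_of_tendsto' (tendsto_pow_atTop_nhds_zero_of_lt_one (by norm_num) (by norm_num)) hle
  rw [ae_iff]
  exact (measureReal_eq_zero_iff).1 (le_antisymm h0 measureReal_nonneg)

end Run

/-- Inverting the logarithm gives `L ≤ μ / γ^ℓ` for `L > 0`. The natural-number ceiling sends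
negative logarithms to `0`, and `logb` vanishes at `0`, so for `κ < 1`, including `L = 0`, the
threshold is just `1`. -/
theorem Input.Valid.mul_etaY_le_one {N : ℕ} {n : Fin N → ℕ} {m : ℕ} {A : Input n m}
    {D : Problem n m} (hA : A.Valid D) (L : ℝ≥0) {ℓ : ℕ}
    (hℓ : max 1 ⌈Real.logb (1 / A.γ) ((L : ℝ) / A.μ)⌉₊ ≤ ℓ) : L * A.etaY ℓ ≤ 1 := by
  have hμ := hA.μ_pos
  have hγ := hA.γ_pos
  rcases eq_or_lt_of_le L.2 with h0 | hpos
  · have : (L : ℝ) = 0 := h0.symm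
    rw [this, zero_mul]
    exact zero_le_one
  · have hL : 0 < (L : ℝ) := hpos
    have h1 : Real.logb (1 / A.γ) ((L : ℝ) / A.μ) ≤ (ℓ : ℝ) :=
      (Nat.le_ceil _).trans (by exact_mod_cast (le_max_right _ _).trans hℓ)
    rw [Real.logb_le_iff_le_rpow ((one_lt_div hγ).2 hA.γ_lt_one) (by positivity),
      Real.rpow_natCast, one_div_pow, div_le_iff₀ hμ, one_div_mul_eq_div,
      le_div_iff₀ (by positivity)] at h1
    rw [Input.etaY_eq, ← mul_div_assoc, div_le_one hμ]
    exact h1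

end SGDAB

end

theorem mainTheorem4 {N : ℕ} (hN : 1 ≤ N) {n : Fin N → ℕ} {m : ℕ}
    {Ξx Ξy Ω : Type*} [MeasurableSpace Ξx] [MeasurableSpace Ξy] [MeasurableSpace Ω]
    (Px : Measure Ξx) [IsProbabilityMeasure Px] (Py : Measure Ξy) [IsProbabilityMeasure Py]
    (P : Measure Ω) [IsProbabilityMeasure P]
    (D : SGDAB.Problem n m) (O : SGDAB.Oracle n m Ξx Ξy) (A : SGDAB.Input n m) (L : ℝ≥0)
    (hD : D.Regular L A.μ A.Fbar) (hO : O.Valid D Px Py A.σx A.σy) (hA : A.Valid D)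
    (R : SGDAB.Sampling N A.numRuns Ξx Ξy Ω) (hR : R.Valid P Px Py (A.numIter D)) :
    (∀ᵐ a ∂P, SGDAB.stopRound A D O R a < ⊤) ∧
    1 - A.p ≤ P.real {a | SGDAB.stopRound A D O R a ≤
      ((max 1 ⌈Real.logb (1 / A.γ) ((L : ℝ) / A.μ)⌉₊ : ℕ) : ℕ∞)} ∧
    ∀ ℓ : ℕ, 1 ≤ ℓ → (L : ℝ) * A.etaY ℓ ≤ 1 →
      1 - A.p ≤ P.real {a | SGDAB.stopCond A D O R ℓ a} := by
  refine ⟨SGDAB.ae_stopRound_lt_top hD hA hN hO hR (le_max_left 1 _)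
    fun ℓ hℓ => hA.mul_etaY_le_one L hℓ, ?_, fun ℓ hℓ hL =>
    SGDAB.le_measureReal_stopCond hD hA hN hO hR hℓ hL⟩
  exact (SGDAB.le_measureReal_stopCond hD hA hN hO hR (le_max_left 1 _)
    (hA.mul_etaY_le_one L le_rfl)).trans
    (measureReal_mono fun a ha => SGDAB.stopRound_le (le_max_left 1 _) ha)
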